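/- Let $s,k\ge 2$ be integers, let $n:=sk$, and let $$f_\Delta(u_1,\dots,u_n)=u_1+\cdots+u_n+\frac{1}{u_1\cdots u_{n-1}u_n^{s}}$$ on $(\mathbb{C}^*)^n$. For a Laurent polynomial $f=\sum_{m\in\mathbb{Z}^n}a_mu^m$ put $\operatorname{supp} f=\{m: a_m\ne 0\}$ and let $P$, the Newton polytope of $f$, be the convex hull of $\operatorname{supp} f$ in $\mathbb{R}^n$. Say that $f$ is *convenient* if $0$ is an interior point of $P$, and *nondegenerate* (in the sense of Kouchnirenko) if for each face $F$ of $\operatorname{conv}(\{0\}\cup\operatorname{supp} f)$ not containing $0$ (if $f$ is convenient: each nonempty proper face of $P$) the functions $u_i\,\partial f_F/\partial u_i$, $1\le i\le n$, have no common zero in $(\mathbb{C}^*)^n$, where $f_F=\sum_{m\in F}a_mu^m$. Let $\mathcal{B}=\mathbb{C}[u_1^{\pm1},\dots,u_n^{\pm1}]$ and $\mathcal{A}_f=\mathcal{B}/(u_1\partial f/\partial u_1,\dots,u_n\partial f/\partial u_n)$. The *Milnor number* of $f$ is $\dim_{\mathbb{C}}\mathcal{A}_f$, and the Milnor number of $P$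 is $n!\operatorname{vol}(P)$, with $\operatorname{vol}([0,1]^n)=1$. For a convenient $f$ let $\nu:\mathbb{R}^n\to\mathbb{R}$ be the Newton function of $P$: it is $1$ at the vertices of $P$ and linear on the cone over each proper face of $P$. For $\alpha\in\mathbb{Q}$ let $\mathcal{N}_\alpha\mathcal{B}$ be the space of those $g\in\mathcal{B}$ with $\nu\le\alpha$ on $\operatorname{supp} g$, let $\mathcal{N}_\alpha\mathcal{A}_f$ be its image in $\mathcal{A}_f$, and let $\operatorname{gr}_\alpha\mathcal{A}_f=\mathcal{N}_\alpha\mathcal{A}_f/\bigcup_{\beta<\alpha}\mathcal{N}_\beta\mathcal{A}_f$. The *spectrum at infinity* of $f$ is $\operatorname{Spec}_f(z)=\sum_{\alpha\in\mathbb{Q}}\dim_{\mathbb{C}}(\operatorname{gr}_\alpha\mathcal{A}_f)\,z^\alpha$. Multiplication by $f$ induces maps $[f]:\operatorname{gr}_\alpha\mathcal{A}_f\to\operatorname{gr}_{\alpha+1}\mathcal{A}_f$, and $f$ satisfies the *hard Lefschetz property* (HL) if $$[f]^{n-1-2i}:\operatorname{gr}_{\alpha+i}\mathcal{A}_f\to\operatorname{gr}_{\alpha+n-1-i}\mathcal{A}_f\quad\text{for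 } 0\le i\le\lfloor (n-1)/2\rfloor,\ \alpha\in\,]0,1[\,\cap\,\mathbb{Q},$$ $$[f]^{n-2i}:\operatorname{gr}_{i}\mathcal{A}_f\to\operatorname{gr}_{n-i}\mathcal{A}_f\quad\text{for } 0\le i\le\lfloor n/2\rfloor$$ are all isomorphisms. A polynomial $\sum_i a_iz^i$ is *unimodal* if there is an index $j$ with $a_i\le a_{i+1}$ for all $i<j$ and $a_i\ge a_{i+1}$ for all $i\ge j$. Then: 1. $f_\Delta$ is convenient and nondegenerate; 2. the Milnor number of $f_\Delta$ is $s(k+1)$, and so is that of its Newton polytope; 3. $\operatorname{Spec}_{f_\Delta}(z)=\sum_{i=0}^{sk}z^i+\sum_{j=1}^{s-1}z^{jk}$; 4. the polynomial $\operatorname{Spec}_{f_\Delta}(z)$ is unimodal if and only if $s=2$; 5. $f_\Delta$ satisfies (HL) if and only if $s=2$. -/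

import Mathlib

open Polynomial

namespace LaurentHL

noncomputable section

/-- Laurent polynomials in `n` variables over `ℂ`; `single m a` is the monomial `a u^m`. -/
abbrev Laurent (n : ℕ) : Type := AddMonoidAlgebra ℂ (Fin n → ℤ)

variable {n : ℕ}

/-- The set `{m : a_m ≠ 0}` of exponents of a Laurent polynomial. -/
def supp (f : Laurent n) : Finset (Fin n → ℤ) := f.coeff.support

/-- The inclusion of the lattice `ℤⁿ` in `ℝⁿ`. -/
def toReal (m : Fin n → ℤ) : Fin n → ℝ := fun i => (m i : ℝ)

/-- The logarithmic partial derivative `u_i ∂f/∂u_i`. -/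
def logPartial (i : Fin n) (f : Laurent n) : Laurent n :=
  f.coeff.sum fun m a => AddMonoidAlgebra.single m ((m i : ℂ) * a)

/-- The value of a Laurent polynomial at a point of the torus `(ℂ^*)ⁿ`. -/
def evalAt (u : Fin n → ℂˣ) (f : Laurent n) : ℂ :=
  f.coeff.sum fun m a => a * ((∏ i, u i ^ m i : ℂˣ) : ℂ)

/-- The part of `f` supported in a subset `F` of `ℝⁿ`. -/
def part (F : Set (Fin n → ℝ)) (f : Laurent n) : Laurent n :=
  open Classical in AddMonoidAlgebra.ofCoeff (f.coeff.filter fun m => toReal m ∈ F)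

/-- The Newton polytope: the convex hull of the support in `ℝⁿ`. -/
def newtonPolytope (f : Laurent n) : Set (Fin n → ℝ) :=
  convexHull ℝ (toReal '' (supp f : Set (Fin n → ℤ)))

/-- `f` is convenient: the origin is an interior point of its Newton polytope. -/
def IsConvenient (f : Laurent n) : Prop :=
  (0 : Fin n → ℝ) ∈ interior (newtonPolytope f)

/-- Kouchnirenko's nondegeneracy: for every face `F` of `conv({0} ∪ supp f)` which does not contain
the origin, the functions `u_i ∂f_F/∂u_i`, where `f_F` is the part of `f` supported in `F`, have no
common zero in the torus. (For a convenient `f`, these faces are the proper nonempty faces of the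
Newton polytope.) -/
def IsNondegenerate (f : Laurent n) : Prop :=
  ∀ F : Set (Fin n → ℝ),
    IsExposed ℝ (convexHull ℝ (insert 0 (toReal '' (supp f : Set (Fin n → ℤ))))) F →
    F.Nonempty → (0 : Fin n → ℝ) ∉ F →
    ∀ u : Fin n → ℂˣ, ∃ i : Fin n, evalAt u (logPartial i (part F f)) ≠ 0

/-- The ideal generated by the logarithmic partial derivatives of `f`. -/
def jacobianIdeal (f : Laurent n) : Ideal (Laurent n) :=
  Ideal.span (Set.range fun i : Fin n => logPartial i f)

/-- The Jacobi ring `𝒜_f`. -/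
abbrev JacobiRing (f : Laurent n) : Type := Laurent n ⧸ jacobianIdeal f

/-- The (global) Milnor number of `f`: the dimension of its Jacobi ring. -/
def milnorNumber (f : Laurent n) : ℕ := Module.finrank ℂ (JacobiRing f)

/-- The Milnor number `n! vol(P)` of a polytope, the unit cube having volume `1`. -/
def polytopeMilnorNumber (P : Set (Fin n → ℝ)) : ENNReal :=
  (n.factorial : ENNReal) * MeasureTheory.volume P

/-- The Newton function of a polytope `P` with the origin in its interior, as the Minkowski
functional of `P`. The two lemmas that follow show that it takes the value `1` at the vertices of
`P` and is linear on the cone over each proper face of `P`, as a Newton function has to. -/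
def newtonFunction (P : Set (Fin n → ℝ)) (x : Fin n → ℝ) : ℝ := gauge P x

theorem newtonFunction_on_cone {P : Set (Fin n → ℝ)} (h0 : (0 : Fin n → ℝ) ∈ interior P)
    {F : Set (Fin n → ℝ)} (hF : IsExposed ℝ P F) (hne : F ≠ P) :
    ∃ l : (Fin n → ℝ) →ₗ[ℝ] ℝ, ∀ x ∈ F, ∀ t : ℝ, 0 ≤ t →
      newtonFunction P (t • x) = l (t • x) ∧ newtonFunction P x = 1 := by
  rcases F.eq_empty_or_nonempty with rfl | hn
  · exact ⟨0, by simp⟩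
  obtain ⟨l, hl⟩ := hF hn
  obtain ⟨y, hy⟩ := hn
  have hyl : y ∈ {x ∈ P | ∀ z ∈ P, l z ≤ l x} := hl ▸ hy
  have h0P : (0 : Fin n → ℝ) ∈ P := interior_subset h0
  have habs : Absorbent ℝ P := absorbent_nhds_zero (mem_interior_iff_mem_nhds.1 h0)
  have hc0 : 0 ≤ l y := by simpa using hyl.2 0 h0P
  have hc : 0 < l y := by
    rcases hc0.lt_or_eq with h | h
    · exact h
    exfalso
    have hle : ∀ z, l z ≤ 0 := by
      intro z
      obtain ⟨r, hr, hz⟩ := exists_lt_of_gauge_lt habs (lt_add_one (gauge P z))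
      obtain ⟨w, hw, rfl⟩ := hz.2
      have := hyl.2 w hw
      rw [map_smul, smul_eq_mul]
      nlinarith
    have hz : ∀ z, l z = 0 := fun z => le_antisymm (hle z) (by simpa using hle (-z))
    apply hne
    rw [hl]
    ext x
    simp [hz]
  have key : ∀ x ∈ F, newtonFunction P x = 1 ∧ l x = l y := by
    intro x hx
    have hxl : x ∈ {x ∈ P | ∀ z ∈ P, l z ≤ l x} := hl ▸ hx
    have hxy : l x = l y := le_antisymm (hyl.2 x hxl.1) (hxl.2 y hyl.1)
    refine ⟨le_antisymm (gauge_le_one_of_mem hxl.1) ?_, hxy⟩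
    by_contra! hlt
    obtain ⟨r, hr, hr1, w, hw, hwx⟩ := exists_lt_of_gauge_lt habs hlt
    have h1 := hyl.2 w hw
    have h2 : l x = r * l w := by rw [← hwx]; simp
    nlinarith
  refine ⟨(l y)⁻¹ • (l : (Fin n → ℝ) →ₗ[ℝ] ℝ), fun x hx t ht => ⟨?_, (key x hx).1⟩⟩
  have h1 := (key x hx).1
  have h2 := (key x hx).2
  simp only [newtonFunction] at h1 ⊢
  rw [gauge_smul_of_nonneg ht, h1]
  simp [h2, hc.ne']

theorem newtonFunction_vertex {P : Set (Fin n → ℝ)} (hn : n ≠ 0)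
    (h0 : (0 : Fin n → ℝ) ∈ interior P) {v : Fin n → ℝ} (hv : v ∈ P.extremePoints ℝ) :
    newtonFunction P v = 1 := by
  have hnt : Nontrivial (Fin n → ℝ) := by
    have : Nonempty (Fin n) := ⟨⟨0, Nat.pos_of_ne_zero hn⟩⟩
    infer_instance
  refine le_antisymm (gauge_le_one_of_mem hv.1) ?_
  by_contra! hlt
  have habs : Absorbent ℝ P := absorbent_nhds_zero (mem_interior_iff_mem_nhds.1 h0)
  by_cases hv0 : v = 0
  · subst hv0
    obtain ⟨w, hw⟩ := exists_ne (0 : Fin n → ℝ)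
    have hs : ∀ᶠ t : ℝ in nhds 0, t • w ∈ P ∧ (-t) • w ∈ P := by
      have hP := mem_interior_iff_mem_nhds.1 h0
      have c1 : Filter.Tendsto (fun t : ℝ => t • w) (nhds 0) (nhds 0) := by
        have : Continuous fun t : ℝ => t • w := by fun_prop
        simpa using this.tendsto 0
      have c2 : Filter.Tendsto (fun t : ℝ => (-t) • w) (nhds 0) (nhds 0) := by
        have : Continuous fun t : ℝ => (-t) • w := by fun_prop
        simpa using this.tendsto 0
      exact (c1.eventually hP).and (c2.eventually hP)
    obtain ⟨e, he, hb⟩ := Metric.eventually_nhds_iff.1 hs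
    have hb' := @hb (e / 2) (by rw [dist_zero_right, Real.norm_eq_abs, abs_of_pos] <;> linarith)
    have := hv.2 hb'.1 hb'.2 ⟨1 / 2, 1 / 2, by norm_num, by norm_num, by norm_num, by module⟩
    have h2 : e / 2 ≠ 0 := by positivity
    exact (smul_ne_zero h2 hw) this
  · obtain ⟨r, hr, hr1, w, hw, hwx⟩ := exists_lt_of_gauge_lt habs hlt
    have h0P : (0 : Fin n → ℝ) ∈ P := interior_subset h0
    have hwv : w = v := hv.2 hw h0P ⟨r, 1 - r, hr, by linarith, by ring, by simpa using hwx⟩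
    subst hwv
    have : (1 - r) • w = 0 := by
      rw [sub_smul, one_smul, sub_eq_zero]; exact hwx.symm
    rcases smul_eq_zero.1 this with h | h
    · linarith
    · exact hv0 h

/-- The step `𝒩_α ℬ` of the Newton filtration on Laurent polynomials: all exponents `m` of `g`
satisfy `ν(m) ≤ α`, for the Newton function `ν` of the Newton polytope of `f`. -/
def newtonStep (f : Laurent n) (α : ℚ) : Submodule ℂ (Laurent n) where
  carrier := {g | ∀ m, g.coeff m ≠ 0 → newtonFunction (newtonPolytope f) (toReal m) ≤ (α : ℝ)}
  zero_mem' := by simp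
  add_mem' := by
    intro a b ha hb m hm
    by_cases h : a.coeff m = 0
    · exact hb m fun h' => hm (by simp [h, h'])
    · exact ha m h
  smul_mem' := by
    intro c a ha m hm
    exact ha m fun h => hm (by simp [h])

/-- The Newton filtration `𝒩_α 𝒜_f` on the Jacobi ring, induced by projection. -/
def jacobiStep (f : Laurent n) (α : ℚ) : Submodule ℂ (JacobiRing f) :=
  (newtonStep f α).map (Ideal.Quotient.mkₐ ℂ (jacobianIdeal f)).toLinearMap

/-- `𝒩_{<α} 𝒜_f`, the union of the steps `𝒩_β 𝒜_f` with `β < α`. -/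
def jacobiStepLT (f : Laurent n) (α : ℚ) : Submodule ℂ (JacobiRing f) :=
  ⨆ β : ℚ, ⨆ _ : β < α, jacobiStep f β

/-- The graded piece `gr_α 𝒜_f = 𝒩_α 𝒜_f / 𝒩_{<α} 𝒜_f`. -/
abbrev Gr (f : Laurent n) (α : ℚ) : Type :=
  jacobiStep f α ⧸ (jacobiStepLT f α).submoduleOf (jacobiStep f α)

/-- The spectrum at infinity of `f`: the formal sum `∑_{α ∈ ℚ} dim(gr_α 𝒜_f) z^α`, as the function
sending `α` to the coefficient of `z^α`. -/
def spectrumAtInfinity (f : Laurent n) : ℚ → ℕ := fun α => Module.finrank ℂ (Gr f α)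

/-- A polynomial as a formal sum of powers `z^α` with rational exponents. -/
def ofPolynomial (p : ℕ[X]) : ℚ → ℕ := p.sum fun i a => Pi.single (i : ℚ) a

/-- A polynomial `a_0 + a_1 z + ⋯` is unimodal if `a_i ≤ a_{i+1}` for `i < j` and
`a_i ≥ a_{i+1}` for `i ≥ j`, for some index `j`. -/
def IsUnimodal (p : ℕ[X]) : Prop :=
  ∃ j : ℕ, (∀ i < j, p.coeff i ≤ p.coeff (i + 1)) ∧ ∀ i ≥ j, p.coeff (i + 1) ≤ p.coeff i

/-- The spectrum at infinity of `f` is a unimodal polynomial. -/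
def HasUnimodalSpectrum (f : Laurent n) : Prop :=
  ∃ p : ℕ[X], spectrumAtInfinity f = ofPolynomial p ∧ IsUnimodal p

theorem mul_mem_newtonStep {f : Laurent n} (hf : IsConvenient f) {α : ℚ} {g : Laurent n}
    (hg : g ∈ newtonStep f α) : f * g ∈ newtonStep f (α + 1) := by
  classical
  intro m hm
  have hm' : m ∈ (f * g).coeff.support := Finsupp.mem_support_iff.2 hm
  obtain ⟨a, ha, b, hb, rfl⟩ := Finset.mem_add.1 (AddMonoidAlgebra.support_coeff_mul_subset f g hm')
  have habs : Absorbent ℝ (newtonPolytope f) :=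
    absorbent_nhds_zero (mem_interior_iff_mem_nhds.1 hf)
  have h1 : newtonFunction (newtonPolytope f) (toReal a) ≤ 1 :=
    gauge_le_one_of_mem (subset_convexHull ℝ _ ⟨a, ha, rfl⟩)
  have h2 := hg b (Finsupp.mem_support_iff.1 hb)
  have h3 : toReal (a + b) = toReal a + toReal b := by ext i; simp [toReal]
  have hcx : Convex ℝ (newtonPolytope f) := convex_convexHull ℝ _
  have h4 := gauge_add_le hcx habs (toReal a) (toReal b)
  rw [h3]
  simp only [newtonFunction] at *
  push_cast
  exact h4.trans (by linarith)

theorem pow_mul_mem_newtonStep {f : Laurent n} (hf : IsConvenient f) {α : ℚ} {g : Laurent n}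
    (hg : g ∈ newtonStep f α) (r : ℕ) : f ^ r * g ∈ newtonStep f (α + r) := by
  induction r with
  | zero => simpa using hg
  | succ r ih =>
    have := mul_mem_newtonStep hf ih
    have e : α + ((r + 1 : ℕ) : ℚ) = α + r + 1 := by push_cast; ring
    rw [pow_succ', mul_assoc, e]
    exact this

/-- Multiplication by the class of `f ^ r` on the Jacobi ring, i.e. the `r`-th iterate of
multiplication by `f`. -/
def mulPow (f : Laurent n) (r : ℕ) : JacobiRing f →ₗ[ℂ] JacobiRing f :=
  LinearMap.mulLeft ℂ ((Ideal.Quotient.mk (jacobianIdeal f) f) ^ r)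

theorem mulPow_mem_jacobiStep {f : Laurent n} (hf : IsConvenient f) {r : ℕ} {α β : ℚ}
    (h : β = α + r) {x : JacobiRing f} (hx : x ∈ jacobiStep f α) :
    mulPow f r x ∈ jacobiStep f β := by
  subst h
  obtain ⟨g, hg, rfl⟩ := hx
  exact ⟨f ^ r * g, pow_mul_mem_newtonStep hf hg r, by simp [mulPow]⟩

theorem mulPow_mem_jacobiStepLT {f : Laurent n} (hf : IsConvenient f) {r : ℕ} {α β : ℚ}
    (h : β = α + r) {x : JacobiRing f} (hx : x ∈ jacobiStepLT f α) :
    mulPow f r x ∈ jacobiStepLT f β := by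
  have hle : jacobiStepLT f α ≤ (jacobiStepLT f β).comap (mulPow f r) := by
    refine iSup₂_le fun γ hγ y hy => ?_
    have hlt : γ + r < β := by rw [h]; linarith
    exact (le_iSup₂ (f := fun (δ : ℚ) (_ : δ < β) => jacobiStep f δ) (γ + r) hlt)
      (mulPow_mem_jacobiStep hf rfl hy)
  exact hle hx

/-- The map `[f]^r : gr_α 𝒜_f → gr_β 𝒜_f`, `β = α + r`, induced by the `r`-fold multiplication
by `f`. -/
def lefschetzMap (f : Laurent n) (hf : IsConvenient f) (r : ℕ) (α β : ℚ) (h : β = α + r) :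
    Gr f α →ₗ[ℂ] Gr f β :=
  Submodule.mapQ _ _
    ((mulPow f r).restrict (p := jacobiStep f α) (q := jacobiStep f β)
      fun _ hx => mulPow_mem_jacobiStep hf h hx)
    fun _ hx => mulPow_mem_jacobiStepLT hf h hx

/-- The hard Lefschetz property (HL) of a convenient Laurent polynomial in `n` variables. The index
`r` stands for `n - 1 - 2k` in the first condition and for `n - 2k` in the second one, with
`0 ≤ k ≤ ⌊(n-1)/2⌋` and `0 ≤ k ≤ ⌊n/2⌋` respectively. -/
def SatisfiesHL (f : Laurent n) (hf : IsConvenient f) : Prop :=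
  (∀ (k r : ℕ) (h : 2 * k + r + 1 = n) (α : ℚ), 0 < α → α < 1 →
    Function.Bijective
      (lefschetzMap f hf r (α + k) (α + (n : ℚ) - 1 - k) (by subst h; push_cast; ring))) ∧
  (∀ (k r : ℕ) (h : 2 * k + r = n),
    Function.Bijective
      (lefschetzMap f hf r (k : ℚ) ((n : ℚ) - k) (by subst h; push_cast; ring)))

/-- The Laurent polynomial `u_1 + ⋯ + u_n + 1 / (u_1 ⋯ u_{n-1} u_n^s)`. -/
def fDelta (n s : ℕ) : Laurent n :=
  ∑ i : Fin n, AddMonoidAlgebra.single (Pi.single i (1 : ℤ)) (1 : ℂ) +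
    AddMonoidAlgebra.single (fun i : Fin n => if (i : ℕ) + 1 = n then -(s : ℤ) else -1) (1 : ℂ)

end

end LaurentHL

/-! The polynomial is the case `w = (1, …, 1, s)` of `simplexLaurent w` = u_1 + ⋯ + u_n + u^(-w),
whose Newton polytope is a simplex with vertices -w, e_1, …, e_n. The relation (-w) + ∑ w_i e_i = 0
puts the origin in the interior, and the total weight N = 1 + ∑ w_i, here s(k+1), governs
everything.

Jacobi ring. The relations are u_i = w_i u^(-w). After rescaling by a suitable τ, every u_i and
u^(-w) becomes a scalar multiple of one element T with T^N = 1. Hence the ring is the group algebra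
of ℤ/N (`jacobiEquiv`): u^m is a nonzero multiple of T^(∑ m_i), and f acts as NτT
(`cyclicMap_simplexLaurent`). Its dimension is N, which is also the normalized volume of the
simplex.

Newton filtration. The Newton function is the maximum of the facet forms
(`newtonFunction_simplexLaurent_le_iff`). Monomials map to multiples of powers of T, so the
filtration is spanned by powers of T, and the degree of T^v is the least ν(m) with ∑ m_i ≡ v mod N.
It is v for 0 ≤ v ≤ sk and kr for v = -r with 0 < r < s: `exists_newtonFunction_le_spectralDegree`
exhibits monomials attaining it and `spectralDegree_le_of_newtonFunction_le` is the lower bound. The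
spectrum follows by counting.

Lefschetz. Multiplication by f^r shifts the exponent of T by r, up to a nonzero factor. For s = 2
the only exceptional element is T^(-1), in the middle degree k, where r = 0; elsewhere the shift
sends T^i to T^(2k-i). For s ≥ 3, T^(-1) has degree k < n/2, but f^((s-2)k) sends it to a multiple
of T^((s-2)k-1), whose degree is below (s-1)k, so its class is killed. Likewise the spectrum has
coefficient 2 at k and at 2k, with 1 in between, and is not unimodal. -/

namespace LaurentHL

noncomputable section

/-! ### Weighted simplices: facets, Newton function, nondegeneracy -/

section Simplex

variable {n : ℕ}

/-- The vertices `-w` and `e_1, …, e_n` of the simplex attached to a weight vector `w`. -/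
def simplexVertex (w : Fin n → ℕ) : Option (Fin n) → Fin n → ℤ
  | none => fun i => -(w i : ℤ)
  | some j => Pi.single j 1

/-- The Laurent polynomial `u_1 + ⋯ + u_n + 1 / u^w`. -/
def simplexLaurent (w : Fin n → ℕ) : Laurent n :=
  ∑ o, AddMonoidAlgebra.single (simplexVertex w o) (1 : ℂ)

/-- The sum `1 + w_1 + ⋯ + w_n` of all weights. -/
def totalWeight (w : Fin n → ℕ) : ℕ := 1 + ∑ i, w i

theorem totalWeight_pos (w : Fin n → ℕ) : 0 < totalWeight w := by
  unfold totalWeight; omega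

/-- The weights of the variables of `fDelta n s`. -/
def deltaWeight (n s : ℕ) (i : Fin n) : ℕ := if (i : ℕ) + 1 = n then s else 1

theorem fDelta_eq_simplexLaurent (n s : ℕ) : fDelta n s = simplexLaurent (deltaWeight n s) := by
  rw [fDelta, simplexLaurent, Fintype.sum_option, add_comm]
  congr 2
  ext i
  simp only [simplexVertex, deltaWeight]
  split_ifs <;> simp

theorem mem_supp_simplexLaurent {w : Fin n → ℕ} {m : Fin n → ℤ} :
    m ∈ supp (simplexLaurent w) ↔ ∃ o, simplexVertex w o = m := by
  classical
  have h : (simplexLaurent w).coeff m =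
      ((Finset.univ.filter fun o => simplexVertex w o = m).card : ℂ) := by
    rw [simplexLaurent, AddMonoidAlgebra.coeff_sum, Finsupp.finsetSum_apply, Finset.card_filter,
      Nat.cast_sum]
    refine Finset.sum_congr rfl fun o _ => ?_
    rw [AddMonoidAlgebra.coeff_single, Finsupp.single_apply]
    split_ifs <;> simp
  rw [supp, Finsupp.mem_support_iff, h, Nat.cast_ne_zero, Finset.card_ne_zero,
    Finset.filter_nonempty_iff]
  simp

theorem newtonPolytope_simplexLaurent (w : Fin n → ℕ) :
    newtonPolytope (simplexLaurent w) =
      convexHull ℝ (Set.range fun o => toReal (simplexVertex w o)) := by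
  rw [newtonPolytope]
  congr 1
  ext x
  constructor
  · rintro ⟨m, hm, rfl⟩
    obtain ⟨o, rfl⟩ := mem_supp_simplexLaurent.1 hm
    exact ⟨o, rfl⟩
  · rintro ⟨o, rfl⟩
    exact ⟨_, mem_supp_simplexLaurent.2 ⟨o, rfl⟩, rfl⟩

/-- The linear form equal to `1` on the facet of the simplex opposite to a given vertex. -/
def facetForm (w : Fin n → ℕ) (o : Option (Fin n)) : (Fin n → ℝ) →ₗ[ℝ] ℝ :=
  ∑ i, LinearMap.proj i -
    o.elim 0 fun j => ((totalWeight w : ℝ) / w j) • (LinearMap.proj j : (Fin n → ℝ) →ₗ[ℝ] ℝ)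

theorem facetForm_none (w : Fin n → ℕ) (x : Fin n → ℝ) : facetForm w none x = ∑ i, x i := by
  simp [facetForm]

theorem facetForm_some (w : Fin n → ℕ) (j : Fin n) (x : Fin n → ℝ) :
    facetForm w (some j) x = ∑ i, x i - (totalWeight w : ℝ) / w j * x j := by
  simp [facetForm]

theorem toReal_simplexVertex_none (w : Fin n → ℕ) (i : Fin n) :
    toReal (simplexVertex w none) i = -(w i : ℝ) := by
  simp [toReal, simplexVertex]

theorem toReal_simplexVertex_some (w : Fin n → ℕ) (j : Fin n) :
    toReal (simplexVertex w (some j)) = Pi.single j 1 := by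
  ext i
  by_cases h : i = j
  · subst h; simp [toReal, simplexVertex]
  · simp [toReal, simplexVertex, Pi.single_eq_of_ne h]

/-- Each form equals 1 at every vertex but the one it is indexed by; the coefficient `totalWeight w
/ w j` is forced by the value 1 at -w. -/
theorem facetForm_simplexVertex_le {w : Fin n → ℕ} (hw : ∀ i, 0 < w i) (o p : Option (Fin n)) :
    facetForm w o (toReal (simplexVertex w p)) ≤ 1 := by
  have ht : (totalWeight w : ℝ) = 1 + ∑ i, (w i : ℝ) := by simp [totalWeight]
  rcases o with _ | j <;> rcases p with _ | i
  · rw [facetForm_none]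
    simp only [toReal_simplexVertex_none, Finset.sum_neg_distrib]
    have : 0 ≤ ∑ i, (w i : ℝ) := Finset.sum_nonneg fun i _ => Nat.cast_nonneg _
    linarith
  · rw [facetForm_none, toReal_simplexVertex_some]
    simp
  · rw [facetForm_some]
    simp only [toReal_simplexVertex_none, Finset.sum_neg_distrib]
    have : (w j : ℝ) ≠ 0 := Nat.cast_ne_zero.2 (hw j).ne'
    field_simp
    linarith
  · rw [facetForm_some, toReal_simplexVertex_some]
    have h : 0 ≤ (totalWeight w : ℝ) / w j * (Pi.single i 1 : Fin n → ℝ) j := by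
      refine mul_nonneg (by positivity) ?_
      by_cases hij : j = i
      · subst hij; simp
      · simp [Pi.single_eq_of_ne hij]
    have h2 : ∑ x, (Pi.single i 1 : Fin n → ℝ) x = 1 := by simp
    linarith

theorem mem_newtonPolytope_simplexLaurent_iff {w : Fin n → ℕ} (hw : ∀ i, 0 < w i)
    {x : Fin n → ℝ} :
    x ∈ newtonPolytope (simplexLaurent w) ↔ ∀ o, facetForm w o x ≤ 1 := by
  have ht : (totalWeight w : ℝ) = 1 + ∑ i, (w i : ℝ) := by simp [totalWeight]
  have ht0 : (0 : ℝ) < totalWeight w := Nat.cast_pos.2 (totalWeight_pos w)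
  rw [newtonPolytope_simplexLaurent]
  constructor
  · intro hx o
    have hc : Convex ℝ {y | facetForm w o y ≤ 1} := convex_halfSpace_le (facetForm w o).isLinear 1
    refine convexHull_min ?_ hc hx
    rintro _ ⟨p, rfl⟩
    exact facetForm_simplexVertex_le hw o p
  · intro hx
    -- Barycentric coordinates of `x`. With weight 1 for the vertex -w, the coordinate at a vertex
    -- is (weight / N)(1 - facet form), so the facet inequalities say exactly that the coordinates
    -- are nonnegative.
    let c : Option (Fin n) → ℝ := fun o =>
      o.elim ((1 - ∑ i, x i) / totalWeight w) fun j =>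
        x j + w j * ((1 - ∑ i, x i) / totalWeight w)
    have hc0 : ∀ o, 0 ≤ c o := by
      rintro (_ | j)
      · have := hx none
        rw [facetForm_none] at this
        exact div_nonneg (by linarith) ht0.le
      · have := hx (some j)
        rw [facetForm_some] at this
        have hj : (0 : ℝ) < w j := Nat.cast_pos.2 (hw j)
        have e : c (some j) = (w j / totalWeight w) *
            (1 - (∑ i, x i - (totalWeight w : ℝ) / w j * x j)) := by
          simp only [c, Option.elim_some]
          field_simp
          ring
        rw [e]
        exact mul_nonneg (by positivity) (by linarith)
    have hc1 : ∑ o, c o = 1 := by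
      rw [Fintype.sum_option]
      simp only [c, Option.elim_none, Option.elim_some, Finset.sum_add_distrib, ← Finset.sum_mul]
      field_simp
      rw [ht]
      ring
    have hcx : ∑ o, c o • toReal (simplexVertex w o) = x := by
      ext j
      rw [Finset.sum_apply, Fintype.sum_option]
      simp only [Pi.smul_apply, toReal_simplexVertex_none, toReal_simplexVertex_some, smul_eq_mul]
      simp [c, Pi.single_apply]
      ring
    rw [← hcx]
    exact (convex_convexHull ℝ _).sum_mem (fun o _ => hc0 o) hc1
      fun o _ => subset_convexHull ℝ _ ⟨o, rfl⟩

theorem isConvenient_simplexLaurent {w : Fin n → ℕ} (hw : ∀ i, 0 < w i) :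
    IsConvenient (simplexLaurent w) := by
  have ho : IsOpen {x : Fin n → ℝ | ∀ o, facetForm w o x < 1} := by
    rw [Set.ofPred_forall]
    refine isOpen_iInter_of_finite fun o => isOpen_lt ?_ continuous_const
    exact LinearMap.continuous_of_finiteDimensional _
  refine mem_interior.2 ⟨_, fun x hx => ?_, ho, fun o => by simp⟩
  exact (mem_newtonPolytope_simplexLaurent_iff hw).2 fun o => (hx o).le

/-- A positive combination of the facet forms vanishes, so they cannot all be negative at one point:
a common upper bound for them is nonnegative. -/
theorem sum_weight_mul_facetForm {w : Fin n → ℕ} (hw : ∀ i, 0 < w i) (x : Fin n → ℝ) :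
    facetForm w none x + ∑ j, w j * facetForm w (some j) x = 0 := by
  have ht : (totalWeight w : ℝ) = 1 + ∑ i, (w i : ℝ) := by simp [totalWeight]
  have e : ∀ j, (w j : ℝ) * facetForm w (some j) x =
      w j * ∑ i, x i - totalWeight w * x j := by
    intro j
    have : (w j : ℝ) ≠ 0 := Nat.cast_ne_zero.2 (hw j).ne'
    rw [facetForm_some]
    field_simp
  rw [facetForm_none, Finset.sum_congr rfl fun j _ => e j, Finset.sum_sub_distrib,
    ← Finset.sum_mul, ← Finset.mul_sum, ht]
  ring

/-- The gauge of a polytope cut out by inequalities l ≤ 1 is the maximum of the forms l. The slack ε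
in both directions is needed because the gauge is an infimum and `a` may be 0. -/
theorem newtonFunction_simplexLaurent_le_iff {w : Fin n → ℕ} (hw : ∀ i, 0 < w i)
    {x : Fin n → ℝ} {a : ℝ} :
    newtonFunction (newtonPolytope (simplexLaurent w)) x ≤ a ↔ ∀ o, facetForm w o x ≤ a := by
  have habs : Absorbent ℝ (newtonPolytope (simplexLaurent w)) :=
    absorbent_nhds_zero (mem_interior_iff_mem_nhds.1 (isConvenient_simplexLaurent hw))
  rw [newtonFunction]
  constructor
  · intro h o
    refine le_of_forall_pos_lt_add fun ε hε => ?_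
    obtain ⟨r, hr, hra, y, hy, rfl⟩ := exists_lt_of_gauge_lt habs (h.trans_lt (lt_add_of_pos_right a hε))
    have := (mem_newtonPolytope_simplexLaurent_iff hw).1 hy o
    simp only [map_smul, smul_eq_mul]
    nlinarith
  · intro h
    have ha : 0 ≤ a := by
      by_contra! ha
      have h1 := sum_weight_mul_facetForm hw x
      have h2 : ∑ j, w j * facetForm w (some j) x ≤ 0 := Finset.sum_nonpos fun j _ =>
        mul_nonpos_of_nonneg_of_nonpos (Nat.cast_nonneg _) ((h _).trans ha.le)
      have h3 := h none
      linarith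
    refine le_of_forall_pos_le_add fun ε hε => ?_
    have hpos : 0 < a + ε := by linarith
    refine gauge_le_of_mem hpos.le ⟨(a + ε)⁻¹ • x, ?_, ?_⟩
    · refine (mem_newtonPolytope_simplexLaurent_iff hw).2 fun o => ?_
      rw [map_smul, smul_eq_mul, inv_mul_le_iff₀ hpos]
      linarith [h o]
    · simp [smul_smul, hpos.ne']

theorem logPartial_single (i : Fin n) (m : Fin n → ℤ) (a : ℂ) :
    logPartial i (AddMonoidAlgebra.single m a) = AddMonoidAlgebra.single m ((m i : ℂ) * a) := by
  rw [logPartial, AddMonoidAlgebra.coeff_single, Finsupp.sum_single_index]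
  simp

theorem logPartial_sum {ι : Type*} (s : Finset ι) (i : Fin n) (g : ι → Laurent n) :
    logPartial i (∑ o ∈ s, g o) = ∑ o ∈ s, logPartial i (g o) := by
  have h0 : logPartial i (0 : Laurent n) = 0 := by simp [logPartial]
  have hadd : ∀ f g : Laurent n, logPartial i (f + g) = logPartial i f + logPartial i g := by
    intro f g
    rw [logPartial, AddMonoidAlgebra.coeff_add, Finsupp.sum_add_index']
    · rfl
    · simp
    · intro m a b; rw [mul_add, AddMonoidAlgebra.single_add]
  exact map_sum (⟨⟨logPartial i, h0⟩, hadd⟩ : Laurent n →+ Laurent n) g s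

theorem evalAt_single (u : Fin n → ℂˣ) (m : Fin n → ℤ) (a : ℂ) :
    evalAt u (AddMonoidAlgebra.single m a) = a * ((∏ i, u i ^ m i : ℂˣ) : ℂ) := by
  rw [evalAt, AddMonoidAlgebra.coeff_single, Finsupp.sum_single_index]
  simp

theorem evalAt_sum {ι : Type*} (s : Finset ι) (u : Fin n → ℂˣ) (g : ι → Laurent n) :
    evalAt u (∑ o ∈ s, g o) = ∑ o ∈ s, evalAt u (g o) := by
  have h0 : evalAt u (0 : Laurent n) = 0 := by simp [evalAt]
  have hadd : ∀ f g : Laurent n, evalAt u (f + g) = evalAt u f + evalAt u g := by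
    intro f g
    rw [evalAt, AddMonoidAlgebra.coeff_add, Finsupp.sum_add_index']
    · rfl
    · simp
    · intro m a b; rw [add_mul]
  exact map_sum (⟨⟨evalAt u, h0⟩, hadd⟩ : Laurent n →+ ℂ) g s

open Classical in
theorem part_simplexLaurent (w : Fin n → ℕ) (F : Set (Fin n → ℝ)) :
    part F (simplexLaurent w) = ∑ o with toReal (simplexVertex w o) ∈ F,
      AddMonoidAlgebra.single (simplexVertex w o) (1 : ℂ) := by
  apply AddMonoidAlgebra.coeff_injective
  have h1 : (part F (simplexLaurent w)).coeff =
      Finsupp.filterAddHom (fun m => toReal m ∈ F) (simplexLaurent w).coeff := rfl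
  rw [h1, simplexLaurent, AddMonoidAlgebra.coeff_sum, map_sum, AddMonoidAlgebra.coeff_sum,
    Finset.sum_filter]
  refine Finset.sum_congr rfl fun o _ => ?_
  split_ifs with h
  · exact Finsupp.filter_single_of_pos _ h
  · exact Finsupp.filter_single_of_neg _ h

/-- A face avoiding the origin contains some vertex and misses another. If it contains -w and misses
e_j, the j-th logarithmic derivative of f_F is the single term -w_j u^(-w); if it misses -w and
contains e_j, it is u_j. Neither vanishes on the torus. -/
theorem isNondegenerate_simplexLaurent {w : Fin n → ℕ} (hw : ∀ i, 0 < w i) :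
    IsNondegenerate (simplexLaurent w) := by
  classical
  intro F hF hne h0 u
  have hconv := isConvenient_simplexLaurent hw
  have hP : convexHull ℝ (insert 0 (toReal '' (supp (simplexLaurent w) : Set (Fin n → ℤ)))) =
      newtonPolytope (simplexLaurent w) := by
    refine (convexHull_min ?_ (convex_convexHull ℝ _)).antisymm
      (convexHull_mono (Set.subset_insert _ _))
    exact Set.insert_subset (interior_subset hconv) (subset_convexHull ℝ _)
  rw [hP, newtonPolytope_simplexLaurent] at hF
  have hFconv : Convex ℝ F := hF.convex (convex_convexHull ℝ _)
  obtain ⟨l, hl⟩ := hF hne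
  -- some vertex lies on the face
  have hv : ∃ o, toReal (simplexVertex w o) ∈ F := by
    obtain ⟨x, hx⟩ := hne
    have hx' := hl ▸ hx
    -- A linear form on a convex hull is dominated by its value at some generating point.
    obtain ⟨_, ⟨o, rfl⟩, ho⟩ :=
      ((l : (Fin n → ℝ) →ₗ[ℝ] ℝ).convexOn (convex_convexHull ℝ
        (Set.range fun o => toReal (simplexVertex w o)))).exists_ge_of_mem_convexHull
        (subset_convexHull ℝ _) hx'.1
    refine ⟨o, hl ▸ ⟨subset_convexHull ℝ _ ⟨o, rfl⟩, fun y hy => (hx'.2 y hy).trans ho⟩⟩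
  -- some vertex does not
  have hv' : ∃ o, toReal (simplexVertex w o) ∉ F := by
    by_contra! h
    apply h0
    have : (0 : Fin n → ℝ) ∈ newtonPolytope (simplexLaurent w) := interior_subset hconv
    rw [newtonPolytope_simplexLaurent] at this
    refine convexHull_min ?_ hFconv this
    rintro _ ⟨o, rfl⟩
    exact h o
  have heval : ∀ i, evalAt u (logPartial i (part F (simplexLaurent w))) =
      ∑ o, if toReal (simplexVertex w o) ∈ F then
        (simplexVertex w o i : ℂ) * ((∏ j, u j ^ simplexVertex w o j : ℂˣ) : ℂ) else 0 := by
    intro i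
    rw [part_simplexLaurent, logPartial_sum, evalAt_sum, Finset.sum_filter]
    simp only [logPartial_single, evalAt_single, mul_one]
  simp only [heval, Fintype.sum_option]
  by_cases hnone : toReal (simplexVertex w none) ∈ F
  · obtain ⟨_ | j, hj⟩ := hv'
    · exact absurd hnone hj
    refine ⟨j, ?_⟩
    rw [if_pos hnone, Finset.sum_eq_zero, add_zero]
    · refine mul_ne_zero ?_ (Units.ne_zero _)
      simpa [simplexVertex] using (hw j).ne'
    · intro i _
      by_cases hij : j = i
      · subst hij; rw [if_neg hj]
      · simp [simplexVertex, Pi.single_eq_of_ne hij]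
  · obtain ⟨_ | j, hj⟩ := hv
    · exact absurd hj hnone
    refine ⟨j, ?_⟩
    rw [if_neg hnone, zero_add, Finset.sum_eq_single j]
    · rw [if_pos hj]
      refine mul_ne_zero ?_ (Units.ne_zero _)
      simp [simplexVertex]
    · intro i _ hij
      simp [simplexVertex, Pi.single_eq_of_ne hij.symm]
    · simp

end Simplex

/-! ### Volume of the Newton polytope -/

section Volume

open MeasureTheory

/-- The simplex of nonnegative vectors with sum at most `t`. -/
def cornerSimplex (n : ℕ) (t : ℝ) : Set (Fin n → ℝ) := {x | (∀ i, 0 ≤ x i) ∧ ∑ i, x i ≤ t}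

/-- Induction by slicing: fixing the first coordinate y in [0, t] leaves a corner simplex of size t
- y, and (t - y)^n / n! is integrated over y. -/
theorem volume_cornerSimplex (n : ℕ) {t : ℝ} (ht : 0 ≤ t) :
    volume (cornerSimplex n t) = ENNReal.ofReal (t ^ n / n.factorial) := by
  induction n generalizing t with
  | zero =>
    have : cornerSimplex 0 t = Set.univ := by
      ext x; simp [cornerSimplex, ht]
    rw [this, volume_pi, Measure.pi_of_empty]
    simp
  | succ n ih =>
    have e := volume_preserving_piFinSuccAbove (fun _ : Fin (n + 1) => ℝ) 0
    have hS : MeasurableSet {p : ℝ × (Fin n → ℝ) | 0 ≤ p.1 ∧ p.2 ∈ cornerSimplex n (t - p.1)} := by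
      have : IsClosed {p : ℝ × (Fin n → ℝ) | 0 ≤ p.1 ∧ (∀ i, 0 ≤ p.2 i) ∧ ∑ i, p.2 i ≤ t - p.1} := by
        refine IsClosed.inter (s₁ := {p : ℝ × (Fin n → ℝ) | 0 ≤ p.1})
          (isClosed_le continuous_const continuous_fst) ?_
        refine IsClosed.inter (s₁ := {p : ℝ × (Fin n → ℝ) | ∀ i, 0 ≤ p.2 i}) ?_ ?_
        · rw [Set.ofPred_forall]
          exact isClosed_iInter fun i => isClosed_le continuous_const (by fun_prop)
        · exact isClosed_le (f := fun p : ℝ × (Fin n → ℝ) => ∑ i, p.2 i) (g := fun p => t - p.1)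
            (by fun_prop) (by fun_prop)
      exact this.measurableSet
    have h1 : cornerSimplex (n + 1) t = MeasurableEquiv.piFinSuccAbove (fun _ => ℝ) 0 ⁻¹'
        {p : ℝ × (Fin n → ℝ) | 0 ≤ p.1 ∧ p.2 ∈ cornerSimplex n (t - p.1)} := by
      ext x
      simp only [cornerSimplex, Set.mem_ofPred_eq, Set.mem_preimage, Fin.forall_fin_succ,
        Fin.sum_univ_succ, MeasurableEquiv.piFinSuccAbove_apply, Fin.insertNthEquiv_symm_apply,
        Fin.removeNth, Fin.succAbove_zero, and_assoc, le_sub_iff_add_le']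
    rw [h1, e.measure_preimage hS.nullMeasurableSet, Measure.volume_eq_prod,
      Measure.prod_apply hS]
    have h2 : ∀ y : ℝ, volume (Prod.mk y ⁻¹'
        {p : ℝ × (Fin n → ℝ) | 0 ≤ p.1 ∧ p.2 ∈ cornerSimplex n (t - p.1)}) =
        (Set.Icc 0 t).indicator (fun y => ENNReal.ofReal ((t - y) ^ n / n.factorial)) y := by
      intro y
      by_cases hy : y ∈ Set.Icc 0 t
      · rw [Set.indicator_of_mem hy, ← ih (sub_nonneg.2 hy.2)]
        congr 1
        ext x
        simp [hy.1]
      · rw [Set.indicator_of_notMem hy, ← measure_empty (μ := (volume : Measure (Fin n → ℝ)))]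
        congr 1
        refine Set.eq_empty_of_forall_notMem fun x hx => hy ⟨hx.1, ?_⟩
        have := (Finset.sum_nonneg fun i _ => hx.2.1 i).trans hx.2.2
        exact sub_nonneg.1 this
    simp_rw [h2]
    rw [lintegral_indicator measurableSet_Icc, ← ofReal_integral_eq_lintegral_ofReal]
    · rw [integral_Icc_eq_integral_Ioc, ← intervalIntegral.integral_of_le ht,
        intervalIntegral.integral_div,
        intervalIntegral.integral_comp_sub_left (fun y => y ^ n) t]
      congr 1
      simp [Nat.factorial_succ]
      field_simp
    · exact (Continuous.continuousOn (by fun_prop)).integrableOn_Icc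
    · refine (ae_restrict_iff' measurableSet_Icc).2 (Filter.Eventually.of_forall fun y hy => ?_)
      exact div_nonneg (pow_nonneg (sub_nonneg.2 hy.2) n) (Nat.cast_nonneg _)

variable {n : ℕ}

theorem volume_newtonPolytope_simplexLaurent {w : Fin n → ℕ} (hw : ∀ i, 0 < w i) :
    volume (newtonPolytope (simplexLaurent w)) =
      ENNReal.ofReal (totalWeight w / n.factorial) := by
  have ht : (totalWeight w : ℝ) = 1 + ∑ i, (w i : ℝ) := by simp [totalWeight]
  have ht0 : (0 : ℝ) < totalWeight w := Nat.cast_pos.2 (totalWeight_pos w)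
  -- The columns e_j + w are the edges of the simplex at the vertex -w, so c ↦ -w + Mc carries the
  -- unit corner simplex onto the polytope. The determinant is that of a rank-one update of the
  -- identity.
  let M : Matrix (Fin n) (Fin n) ℝ := 1 + Matrix.replicateCol Unit (fun i => (w i : ℝ)) *
    Matrix.replicateRow Unit (fun _ => (1 : ℝ))
  have hM : M.det = totalWeight w := by
    rw [Matrix.det_one_add_replicateCol_mul_replicateRow, ht]
    simp [dotProduct]
  let A := Matrix.toLin' M
  have hA : LinearMap.det A = totalWeight w := by rw [LinearMap.det_toLin', hM]
  have hAc : ∀ c i, A c i = c i + w i * ∑ j, c j := by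
    intro c i
    simp [A, M, Matrix.mulVec, dotProduct, Matrix.mul_apply,
      Finset.mul_sum]
  let v := toReal (simplexVertex w none)
  have h1 : A ⁻¹' ((fun y => v + y) ⁻¹' newtonPolytope (simplexLaurent w)) =
      cornerSimplex n 1 := by
    ext c
    have hs : ∑ i, (v + A c) i = ∑ i, c i - (1 - ∑ i, c i) * ∑ i, (w i : ℝ) := by
      simp only [Pi.add_apply, hAc, v, toReal_simplexVertex_none, Finset.sum_add_distrib,
        Finset.sum_neg_distrib, ← Finset.sum_mul]
      ring
    rw [Set.mem_preimage, Set.mem_preimage, mem_newtonPolytope_simplexLaurent_iff hw,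
      Option.forall, facetForm_none, hs, and_comm]
    refine and_congr (forall_congr' fun j => ?_) ?_
    · have hj : (0 : ℝ) < w j := Nat.cast_pos.2 (hw j)
      have e : facetForm w (some j) (v + A c) = 1 - totalWeight w / w j * c j := by
        rw [facetForm_some, hs, Pi.add_apply, hAc]
        simp only [v, toReal_simplexVertex_none]
        field_simp
        rw [ht]
        ring
      rw [e, sub_le_self_iff, mul_nonneg_iff_of_pos_left (by positivity)]
    · have : 0 ≤ ∑ i, (w i : ℝ) := Finset.sum_nonneg fun i _ => Nat.cast_nonneg _
      constructor
      · intro h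
        by_contra! h'
        nlinarith
      · intro h
        nlinarith
  have h2 := Measure.addHaar_preimage_linearMap (volume : Measure (Fin n → ℝ))
    (f := A) (by rw [hA]; exact ht0.ne') ((fun y => v + y) ⁻¹' newtonPolytope (simplexLaurent w))
  rw [h1, measure_preimage_add, volume_cornerSimplex n zero_le_one, hA, abs_of_pos (inv_pos.2 ht0),
    one_pow] at h2
  have h3 : ENNReal.ofReal (totalWeight w) * ENNReal.ofReal (totalWeight w : ℝ)⁻¹ = 1 := by
    rw [← ENNReal.ofReal_mul ht0.le, mul_inv_cancel₀ ht0.ne', ENNReal.ofReal_one]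
  rw [← one_mul (volume _), ← h3, mul_assoc, ← h2, ← ENNReal.ofReal_mul ht0.le]
  congr 1
  ring

theorem polytopeMilnorNumber_simplexLaurent {w : Fin n → ℕ} (hw : ∀ i, 0 < w i) :
    polytopeMilnorNumber (newtonPolytope (simplexLaurent w)) = totalWeight w := by
  rw [polytopeMilnorNumber, volume_newtonPolytope_simplexLaurent hw, ← ENNReal.ofReal_natCast,
    ← ENNReal.ofReal_mul (Nat.cast_nonneg _), mul_div_cancel₀ _ (Nat.cast_ne_zero.2
      n.factorial_ne_zero), ENNReal.ofReal_natCast]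

end Volume

/-! ### The Jacobi ring as the group algebra of ℤ/N -/

section Jacobi

variable {n : ℕ}

theorem prod_zpow_eq_zpow_sum {ι G : Type*} [CommGroup G] (s : Finset ι) (a : G) (f : ι → ℤ) :
    ∏ i ∈ s, a ^ f i = a ^ ∑ i ∈ s, f i := by
  classical
  induction s using Finset.induction_on with
  | empty => simp
  | insert i s hi ih => rw [Finset.prod_insert hi, Finset.sum_insert hi, ih, zpow_add]

/-- The algebra map to the group algebra of `ℤ/N` which sends `u_i` to `c_i` times the
generator. -/
def cyclicMap (N : ℕ) (c : Fin n → ℂˣ) : Laurent n →ₐ[ℂ] AddMonoidAlgebra ℂ (ZMod N) :=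
  AddMonoidAlgebra.lift ℂ _ _
    { toFun := fun m => AddMonoidAlgebra.single ((∑ i, m.toAdd i : ℤ) : ZMod N)
        ((∏ i, c i ^ m.toAdd i : ℂˣ) : ℂ)
      map_one' := by simp [AddMonoidAlgebra.one_def]
      map_mul' := fun m m' => by
        rw [AddMonoidAlgebra.single_mul_single, ← Int.cast_add, ← Finset.sum_add_distrib,
          ← Units.val_mul, ← Finset.prod_mul_distrib]
        simp only [toAdd_mul, Pi.add_apply, zpow_add] }

theorem cyclicMap_single (N : ℕ) (c : Fin n → ℂˣ) (m : Fin n → ℤ) (a : ℂ) :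
    cyclicMap N c (AddMonoidAlgebra.single m a) =
      AddMonoidAlgebra.single ((∑ i, m i : ℤ) : ZMod N) (a * ((∏ i, c i ^ m i : ℂˣ) : ℂ)) := by
  rw [cyclicMap, AddMonoidAlgebra.lift_single]
  simp [AddMonoidAlgebra.smul_single]

/-- Scalars `c_i = w_i τ` that describe the critical points of the Laurent polynomial of a
weighted simplex. -/
structure IsCriticalScaling (w : Fin n → ℕ) (τ : ℂˣ) (c : Fin n → ℂˣ) : Prop where
  coord : ∀ i, (c i : ℂ) = w i * τ
  vertex : ∏ i, c i ^ (-(w i : ℤ)) = τ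

/-- With c_i = w_i τ the remaining condition reads τ^N = ∏ w_i^(-w_i), solvable over ℂ. -/
theorem exists_isCriticalScaling {w : Fin n → ℕ} (hw : ∀ i, 0 < w i) :
    ∃ τ c, IsCriticalScaling w τ c := by
  let ω : Fin n → ℂˣ := fun i => Units.mk0 (w i : ℂ) (Nat.cast_ne_zero.2 (hw i).ne')
  obtain ⟨z, hz⟩ := IsAlgClosed.exists_pow_nat_eq (((∏ i, ω i ^ (-(w i : ℤ)) : ℂˣ) : ℂ))
    (totalWeight_pos w)
  have hz0 : z ≠ 0 := by
    rintro rfl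
    rw [zero_pow (totalWeight_pos w).ne'] at hz
    exact Units.ne_zero _ hz.symm
  let τ := Units.mk0 z hz0
  have hτ : τ ^ totalWeight w = ∏ i, ω i ^ (-(w i : ℤ)) := by
    ext
    rw [← hz]
    simp [τ]
  refine ⟨τ, fun i => ω i * τ, fun i => by simp [ω], ?_⟩
  simp only [mul_zpow, Finset.prod_mul_distrib]
  rw [← hτ, prod_zpow_eq_zpow_sum, Finset.sum_neg_distrib, totalWeight, pow_add, pow_one,
    zpow_neg, ← Nat.cast_sum, zpow_natCast, mul_inv_cancel_right]

/-- All n + 1 vertices thus have coordinate sum 1 mod N, which is why f maps to a multiple of the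
generator. -/
theorem neg_sum_weight_eq_one (w : Fin n → ℕ) :
    ((∑ i, -(w i : ℤ) : ℤ) : ZMod (totalWeight w)) = 1 := by
  have : ((1 + ∑ i, w i : ℕ) : ZMod (totalWeight w)) = 0 := ZMod.natCast_self _
  push_cast at this ⊢
  rw [Finset.sum_neg_distrib]
  linear_combination -this

variable {w : Fin n → ℕ} {τ : ℂˣ} {c : Fin n → ℂˣ}

theorem cyclicMap_simplexVertex_none (h : IsCriticalScaling w τ c) :
    cyclicMap (totalWeight w) c (AddMonoidAlgebra.single (simplexVertex w none) 1) =
      AddMonoidAlgebra.single 1 (τ : ℂ) := by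
  rw [cyclicMap_single]
  simp only [simplexVertex]
  rw [neg_sum_weight_eq_one, h.vertex, one_mul]

theorem cyclicMap_simplexVertex_some (h : IsCriticalScaling w τ c) (j : Fin n) :
    cyclicMap (totalWeight w) c (AddMonoidAlgebra.single (simplexVertex w (some j)) 1) =
      AddMonoidAlgebra.single 1 ((w j : ℂ) * τ) := by
  have e : ∏ i, c i ^ (Pi.single j 1 : Fin n → ℤ) i = c j := by
    rw [Finset.prod_eq_single j] <;> simp +contextual
  rw [cyclicMap_single]
  simp only [simplexVertex]
  rw [e, h.coord, one_mul]
  simp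

theorem cyclicMap_simplexLaurent (h : IsCriticalScaling w τ c) :
    cyclicMap (totalWeight w) c (simplexLaurent w) =
      AddMonoidAlgebra.single 1 ((totalWeight w : ℂ) * τ) := by
  rw [simplexLaurent, map_sum, Fintype.sum_option, cyclicMap_simplexVertex_none h]
  simp only [cyclicMap_simplexVertex_some h]
  change _ + ∑ i, AddMonoidAlgebra.singleAddHom (1 : ZMod (totalWeight w)) ((w i : ℂ) * τ) = _
  rw [← map_sum, AddMonoidAlgebra.singleAddHom_apply, ← AddMonoidAlgebra.single_add,
    ← Finset.sum_mul]
  congr 1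
  rw [totalWeight]
  push_cast
  ring

theorem logPartial_simplexLaurent (w : Fin n → ℕ) (i : Fin n) :
    logPartial i (simplexLaurent w) =
      AddMonoidAlgebra.single (simplexVertex w (some i)) 1 -
        (w i : ℂ) • AddMonoidAlgebra.single (simplexVertex w none) 1 := by
  rw [simplexLaurent, logPartial_sum, Fintype.sum_option, Finset.sum_eq_single i]
  · simp only [logPartial_single, AddMonoidAlgebra.smul_single]
    simp [simplexVertex, AddMonoidAlgebra.single_neg]
    abel
  · intro j _ hj
    simp [logPartial_single, simplexVertex, Pi.single_eq_of_ne hj.symm]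
  · simp

theorem jacobianIdeal_le_ker_cyclicMap (h : IsCriticalScaling w τ c) :
    jacobianIdeal (simplexLaurent w) ≤ RingHom.ker (cyclicMap (totalWeight w) c) := by
  refine Ideal.span_le.2 ?_
  rintro _ ⟨i, rfl⟩
  dsimp only
  rw [SetLike.mem_coe, RingHom.mem_ker, logPartial_simplexLaurent, map_sub, map_smul,
    cyclicMap_simplexVertex_none h, cyclicMap_simplexVertex_some h,
    AddMonoidAlgebra.smul_single, smul_eq_mul, sub_self]

/-- The class of a monomial as a unit of the Jacobi ring. -/
def monomialUnit (f : Laurent n) : Multiplicative (Fin n → ℤ) →* (JacobiRing f)ˣ :=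
  MonoidHom.toHomUnits (((Ideal.Quotient.mk (jacobianIdeal f)).toMonoidHom).comp
    (AddMonoidAlgebra.of ℂ (Fin n → ℤ)))

theorem coe_monomialUnit (f : Laurent n) (m : Fin n → ℤ) :
    (monomialUnit f (.ofAdd m) : JacobiRing f) =
      Ideal.Quotient.mk (jacobianIdeal f) (AddMonoidAlgebra.single m 1) := rfl

theorem hom_eq_of_forall_single {G : Type*} [CommGroup G]
    (θ : Multiplicative (Fin n → ℤ) →* G) (ι : ℂˣ →* G) (U : G)
    (h : ∀ j, θ (.ofAdd (Pi.single j 1)) = ι (c j) * U) (m : Fin n → ℤ) :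
    θ (.ofAdd m) = ι (∏ i, c i ^ m i) * U ^ ∑ i, m i := by
  have hm : m = ∑ i, m i • (Pi.single i 1 : Fin n → ℤ) := by
    ext j
    simp [Finset.sum_apply, Pi.single_apply]
  conv_lhs => rw [hm, ofAdd_sum, map_prod]
  simp only [ofAdd_zsmul, map_zpow, h, mul_zpow, Finset.prod_mul_distrib, map_prod,
    prod_zpow_eq_zpow_sum]

/-- Take U = τ⁻¹ u^(-w). The Jacobian relations u_j = w_j u^(-w) become u_j = c_j U, which
determines all monomials. Applied to u^(-w) itself, this gives τU = τ U^(-∑ w_i), that is, U^N = 1.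
-/
theorem monomialUnit_simplexLaurent (h : IsCriticalScaling w τ c) :
    ∃ U : (JacobiRing (simplexLaurent w))ˣ, U ^ totalWeight w = 1 ∧
      ∀ m : Fin n → ℤ, monomialUnit (simplexLaurent w) (.ofAdd m) =
        Units.map (algebraMap ℂ (JacobiRing (simplexLaurent w))).toMonoidHom (∏ i, c i ^ m i) *
          U ^ (∑ i, m i) := by
  set f := simplexLaurent w
  let ι : ℂˣ →* (JacobiRing f)ˣ := Units.map (algebraMap ℂ (JacobiRing f)).toMonoidHom
  let U := (ι τ)⁻¹ * monomialUnit f (.ofAdd (simplexVertex w none))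
  have hU : monomialUnit f (.ofAdd (simplexVertex w none)) = ι τ * U := by simp [U]
  have hj : ∀ j, monomialUnit f (.ofAdd (Pi.single j 1)) = ι (c j) * U := by
    intro j
    have h1 : monomialUnit f (.ofAdd (Pi.single j 1)) =
        ι (c j * τ⁻¹) * monomialUnit f (.ofAdd (simplexVertex w none)) := by
      ext
      have h2 : Ideal.Quotient.mk (jacobianIdeal f) (logPartial j f) = 0 :=
        Ideal.Quotient.eq_zero_iff_mem.2 (Ideal.subset_span ⟨j, rfl⟩)
      have h3 : ((c j * τ⁻¹ : ℂˣ) : ℂ) = w j := by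
        rw [Units.val_mul, h.coord, mul_assoc, Units.mul_inv, mul_one]
      have h4 : ((ι (c j * τ⁻¹) : (JacobiRing f)ˣ) : JacobiRing f) =
          algebraMap ℂ (JacobiRing f) (w j) := by
        rw [← h3]; rfl
      rw [logPartial_simplexLaurent, map_sub, sub_eq_zero] at h2
      rw [Units.val_mul, h4, coe_monomialUnit, coe_monomialUnit, ← Algebra.smul_def]
      exact h2
    rw [h1, hU, map_mul, map_inv, mul_assoc, inv_mul_cancel_left]
  have hall : ∀ m : Fin n → ℤ, monomialUnit f (.ofAdd m) =
      ι (∏ i, c i ^ m i) * U ^ (∑ i, m i) :=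
    hom_eq_of_forall_single (monomialUnit f) ι U hj
  refine ⟨U, ?_, hall⟩
  have h5 := hall (simplexVertex w none)
  simp only [simplexVertex] at h5 hU
  rw [hU, h.vertex] at h5
  have h6 := mul_left_cancel h5
  rw [Finset.sum_neg_distrib, zpow_neg, ← Nat.cast_sum, zpow_natCast, eq_inv_iff_mul_eq_one] at h6
  rw [totalWeight, pow_add, pow_one, h6]

theorem ker_cyclicMap_le_jacobianIdeal (h : IsCriticalScaling w τ c) :
    RingHom.ker (cyclicMap (totalWeight w) c) ≤ jacobianIdeal (simplexLaurent w) := by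
  obtain ⟨U, hU, hall⟩ := monomialUnit_simplexLaurent h
  have : NeZero (totalWeight w) := ⟨(totalWeight_pos w).ne'⟩
  -- The quotient map factors through `cyclicMap` via T^v ↦ U^v, so it kills the kernel; linearity
  -- of ψ is enough.
  let ψ : AddMonoidAlgebra ℂ (ZMod (totalWeight w)) →ₗ[ℂ] JacobiRing (simplexLaurent w) :=
    Finsupp.linearCombination ℂ (fun z : ZMod (totalWeight w) =>
      ((U ^ z.val : (JacobiRing (simplexLaurent w))ˣ) : JacobiRing (simplexLaurent w))) ∘ₗ
      (AddMonoidAlgebra.coeffLinearEquiv ℂ).toLinearMap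
  have key : ψ ∘ₗ (cyclicMap (totalWeight w) c).toLinearMap =
      (Ideal.Quotient.mkₐ ℂ (jacobianIdeal (simplexLaurent w))).toLinearMap := by
    refine AddMonoidAlgebra.lhom_ext' fun m => LinearMap.ext_ring ?_
    have h1 : Ideal.Quotient.mk (jacobianIdeal (simplexLaurent w)) (AddMonoidAlgebra.single m 1) =
      _ := (coe_monomialUnit _ m).symm.trans (congrArg Units.val (hall m))
    have h2 : U ^ ((∑ i, m i : ℤ) : ZMod (totalWeight w)).val = U ^ (∑ i, m i) := by
      rw [← zpow_natCast, ZMod.val_intCast]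
      conv_rhs => rw [← Int.emod_add_mul_ediv (∑ i, m i) (totalWeight w), zpow_add, zpow_mul,
        zpow_natCast, hU, one_zpow, mul_one]
    have h3 : ψ (cyclicMap (totalWeight w) c (AddMonoidAlgebra.single m 1)) =
        Ideal.Quotient.mk (jacobianIdeal (simplexLaurent w)) (AddMonoidAlgebra.single m 1) := by
      rw [cyclicMap_single, one_mul, h1]
      simp only [ψ, LinearMap.comp_apply, LinearEquiv.coe_coe,
        AddMonoidAlgebra.coeffLinearEquiv_apply, AddMonoidAlgebra.coeff_single,
        Finsupp.linearCombination_single, h2, Units.val_mul]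
      exact Algebra.smul_def (A := JacobiRing (simplexLaurent w)) ((∏ i, c i ^ m i : ℂˣ) : ℂ) _
    exact h3
  intro x hx
  have h4 := LinearMap.congr_fun key x
  rw [LinearMap.comp_apply, AlgHom.toLinearMap_apply, RingHom.mem_ker.1 hx, map_zero] at h4
  exact Ideal.Quotient.eq_zero_iff_mem.1 h4.symm

theorem cyclicMap_surjective (w : Fin n → ℕ) (c : Fin n → ℂˣ) :
    Function.Surjective (cyclicMap (totalWeight w) c) := by
  have : NeZero (totalWeight w) := ⟨(totalWeight_pos w).ne'⟩
  intro y
  induction y using AddMonoidAlgebra.induction_linear with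
  | zero => exact ⟨0, map_zero _⟩
  | add f g hf hg =>
    obtain ⟨x, rfl⟩ := hf
    obtain ⟨y, rfl⟩ := hg
    exact ⟨x + y, map_add _ _ _⟩
  | single z a =>
    let m : Fin n → ℤ := fun i => z.val * -(w i : ℤ)
    refine ⟨AddMonoidAlgebra.single m (a * ((∏ i, c i ^ m i : ℂˣ) : ℂ)⁻¹), ?_⟩
    rw [cyclicMap_single, inv_mul_cancel_right₀ (Units.ne_zero _)]
    congr 1
    rw [← Finset.mul_sum, Int.cast_mul, neg_sum_weight_eq_one]
    simp

/-- The Jacobi ring of a weighted simplex is the group algebra of a cyclic group. -/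
def jacobiEquiv (h : IsCriticalScaling w τ c) :
    JacobiRing (simplexLaurent w) ≃ₐ[ℂ] AddMonoidAlgebra ℂ (ZMod (totalWeight w)) :=
  (Ideal.quotientEquivAlgOfEq ℂ ((jacobianIdeal_le_ker_cyclicMap h).antisymm
    (ker_cyclicMap_le_jacobianIdeal h))).trans
    (Ideal.quotientKerAlgEquivOfSurjective (cyclicMap_surjective w c))

theorem jacobiEquiv_mk (h : IsCriticalScaling w τ c) (x : Laurent n) :
    jacobiEquiv h (Ideal.Quotient.mk _ x) = cyclicMap (totalWeight w) c x := rfl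

theorem milnorNumber_simplexLaurent (hw : ∀ i, 0 < w i) :
    milnorNumber (simplexLaurent w) = totalWeight w := by
  obtain ⟨τ, c, h⟩ := exists_isCriticalScaling hw
  have : NeZero (totalWeight w) := ⟨(totalWeight_pos w).ne'⟩
  rw [milnorNumber, (jacobiEquiv h).toLinearEquiv.finrank_eq,
    (AddMonoidAlgebra.coeffLinearEquiv ℂ).finrank_eq, Module.finrank_finsupp_self, ZMod.card]

end Jacobi

/-! ### Minimal Newton degree in each residue class mod N -/

section SpectralDegree

theorem sum_ite_last {R : Type*} [CommRing R] {n : ℕ} (hn : 0 < n) (x y : R) :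
    ∑ i : Fin n, (if (i : ℕ) + 1 = n then x else y) = x + ((n : R) - 1) * y := by
  obtain ⟨n, rfl⟩ : ∃ l, n = l + 1 := ⟨n - 1, by omega⟩
  rw [Fin.sum_univ_castSucc]
  simp [Fin.val_castSucc, (Fin.is_lt _).ne, add_comm]

theorem totalWeight_deltaWeight {s k : ℕ} (hn : 0 < s * k) :
    totalWeight (deltaWeight (s * k) s) = s * (k + 1) := by
  have h := sum_ite_last (R := ℤ) hn s 1
  have h2 : ((∑ i, deltaWeight (s * k) s i : ℕ) : ℤ) = s + (((s * k : ℕ) : ℤ) - 1) * 1 := by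
    rw [← h]
    simp [deltaWeight]
  zify [totalWeight]
  push_cast at h2
  rw [h2]
  ring

theorem deltaWeight_pos {n s : ℕ} (hs : 0 < s) (i : Fin n) : 0 < deltaWeight n s i := by
  unfold deltaWeight
  split_ifs <;> omega

/-- The degree of the `z`-th power of the generator in the spectrum of `fDelta (s * k) s`. -/
def spectralDegree (s k : ℕ) {N : ℕ} (z : ZMod N) : ℕ :=
  if z.val ≤ s * k then z.val else k * (N - z.val)

variable {s k N : ℕ}

theorem mul_sub_val_lt (hN : N = s * (k + 1)) {v : ℕ} (hv : s * k < v) : k * (N - v) < v := by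
  have h1 : N - v ≤ s := by rw [hN, mul_add_one]; omega
  calc k * (N - v) ≤ k * s := Nat.mul_le_mul_left _ h1
    _ < v := by rwa [mul_comm]

theorem spectralDegree_natCast_le (hN : N = s * (k + 1)) (d : ℕ) :
    spectralDegree s k (d : ZMod N) ≤ d := by
  have h : (d : ZMod N).val ≤ d := by rw [ZMod.val_natCast]; exact Nat.mod_le _ _
  unfold spectralDegree
  split_ifs with h1
  · exact h
  · exact (mul_sub_val_lt hN (not_le.1 h1)).le.trans h

theorem val_neg_natCast {r : ℕ} (hr : 0 < r) (hrN : r < N) : (-(r : ZMod N)).val = N - r := by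
  have : NeZero N := ⟨by omega⟩
  have h : (-(r : ZMod N)) = ((N - r : ℕ) : ZMod N) := by
    rw [Nat.cast_sub hrN.le, ZMod.natCast_self, zero_sub]
  rw [h, ZMod.val_natCast, Nat.mod_eq_of_lt (by omega)]

theorem spectralDegree_neg_natCast (hN : N = s * (k + 1)) {r : ℕ} (hr : 0 < r) (hrs : r < s) :
    spectralDegree s k (-(r : ZMod N)) = k * r := by
  rw [mul_add_one] at hN
  have hrN : r < N := by omega
  rw [spectralDegree, val_neg_natCast hr hrN, if_neg (by omega), Nat.sub_sub_self hrN.le]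

/-- Subadditivity in the form needed: a generator costs at most 1, an inverse generator at most k as
long as fewer than s of them are used. -/
theorem spectralDegree_sub_le (hN : N = s * (k + 1)) (A : ℕ) {r : ℕ}
    (hr : r < s) : spectralDegree s k ((A : ZMod N) - (r : ZMod N)) ≤ A + k * r := by
  rcases le_or_gt r A with h | h
  · rw [← Nat.cast_sub h]
    exact (spectralDegree_natCast_le hN _).trans (by omega)
  · have e : (A : ZMod N) - (r : ZMod N) = -((r - A : ℕ) : ZMod N) := by
      rw [Nat.cast_sub h.le]; ring
    rw [e, spectralDegree_neg_natCast hN (by omega) (by omega)]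
    exact (Nat.mul_le_mul_left k (Nat.sub_le r A)).trans (by omega)

/-- The arithmetic core, bounding ν(m) from below on a residue class. With d = ∑ m_i, the facet
inequalities and integrality bound the last coordinate below by -q and the others by -t, where q =
⌊(a - d)/(k+1)⌋ and t = ⌊(a - d)/N⌋ = ⌊q/s⌋. -/
theorem spectralDegree_sum_le (hN : N = s * (k + 1)) (hs : 0 < s) (hk : 0 < k)
    {m : Fin (s * k) → ℤ} {a : ℤ} (h0 : ∑ i, m i ≤ a)
    (hm : ∀ j : Fin (s * k), (∑ i, m i) - (if (j : ℕ) + 1 = s * k then (k : ℤ) + 1 else N) * m j ≤ a) :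
    (spectralDegree s k ((∑ i, m i : ℤ) : ZMod N) : ℤ) ≤ a := by
  have hn : 0 < s * k := Nat.mul_pos hs hk
  set d := ∑ i, m i with hd
  have hk1 : (0 : ℤ) < k + 1 := by omega
  have hs0 : (0 : ℤ) < s := by omega
  set q := (a - d) / ((k : ℤ) + 1) with hq
  set t := q / s with ht
  have hq0 : 0 ≤ q := Int.ediv_nonneg (by omega) hk1.le
  have ht0 : 0 ≤ t := Int.ediv_nonneg hq0 hs0.le
  have hNz : (N : ℤ) = (k + 1) * s := by rw [hN]; push_cast; ring
  have ht' : t = (a - d) / (N : ℤ) := by rw [ht, hq, Int.ediv_ediv_of_nonneg hk1.le, hNz]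
  have hlow : ∀ j : Fin (s * k), (if (j : ℕ) + 1 = s * k then -q else -t) ≤ m j := by
    intro j
    have hj := hm j
    split_ifs at hj ⊢ with h
    · rw [neg_le, hq, Int.le_ediv_iff_mul_le hk1]
      linarith
    · rw [neg_le, ht', Int.le_ediv_iff_mul_le (by rw [hNz]; positivity)]
      linarith
  have hsum := Finset.sum_le_sum fun j (_ : j ∈ Finset.univ) => hlow j
  rw [sum_ite_last hn, ← hd] at hsum
  push_cast at hsum
  have hqr : s * t + q % s = q := by rw [ht]; exact Int.mul_ediv_add_emod q s
  have hr0 : 0 ≤ q % s := Int.emod_nonneg _ hs0.ne'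
  have hrs : q % s < s := Int.emod_lt_of_pos _ hs0
  obtain ⟨r, hr⟩ := Int.eq_ofNat_of_zero_le hr0
  rw [hr] at hqr hrs
  -- With q = st + r, the number A = d + skt + q satisfies d = A - r - Nt, hence d ≡ A - r mod N
  -- with 0 ≤ r < s. The resulting bound A + kr equals d + q(k+1), which is at most `a`.
  have hA0 : 0 ≤ d + (s * k - 1) * t + q + t := by linarith
  obtain ⟨A, hA⟩ := Int.eq_ofNat_of_zero_le hA0
  have hz : (d : ZMod N) = (A : ZMod N) - (r : ZMod N) := by
    have e : d = (A : ℤ) - r - N * t := by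
      rw [← hA, hNz]; linear_combination hqr
    rw [e]
    push_cast
    rw [ZMod.natCast_self]
    ring
  have hqa : q * (k + 1) ≤ a - d := Int.ediv_mul_le _ hk1.ne'
  rw [hz]
  have h1 : (spectralDegree s k ((A : ZMod N) - (r : ZMod N)) : ℤ) ≤ A + k * r := by
    exact_mod_cast spectralDegree_sub_le hN A (by exact_mod_cast hrs)
  have h2 : (A : ℤ) + k * r = d + q * (k + 1) := by
    rw [← hA]; linear_combination (k : ℤ) * hqr
  linarith

/-- The slope of a facet of the Newton polytope of `fDelta (s * k) s`. -/
theorem totalWeight_div_deltaWeight (hs : 0 < s) (hk : 0 < k) (j : Fin (s * k)) :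
    (totalWeight (deltaWeight (s * k) s) : ℝ) / deltaWeight (s * k) s j =
      ((if (j : ℕ) + 1 = s * k then (k : ℤ) + 1 else
        (totalWeight (deltaWeight (s * k) s) : ℕ) : ℤ) : ℝ) := by
  have hs' : (s : ℝ) ≠ 0 := Nat.cast_ne_zero.2 hs.ne'
  rw [totalWeight_deltaWeight (Nat.mul_pos hs hk), deltaWeight]
  split_ifs <;> push_cast <;> field_simp

theorem spectralDegree_le_of_newtonFunction_le (hs : 0 < s) (hk : 0 < k)
    {m : Fin (s * k) → ℤ} {α : ℚ}
    (h : newtonFunction (newtonPolytope (simplexLaurent (deltaWeight (s * k) s))) (toReal m) ≤ α) :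
    (spectralDegree s k
      ((∑ i, m i : ℤ) : ZMod (totalWeight (deltaWeight (s * k) s))) : ℚ) ≤ α := by
  rw [newtonFunction_simplexLaurent_le_iff (deltaWeight_pos hs), Option.forall] at h
  have hα : ∀ x : ℤ, (x : ℝ) ≤ (α : ℝ) ↔ x ≤ ⌊α⌋ := by
    intro x
    rw [Int.le_floor]
    exact_mod_cast Iff.rfl
  have key := spectralDegree_sum_le (totalWeight_deltaWeight (Nat.mul_pos hs hk)) hs hk (m := m)
    (a := ⌊α⌋) ?_ fun j => ?_
  · rw [Int.le_floor] at key
    exact_mod_cast key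
  · rw [← hα]
    have := h.1
    rw [facetForm_none] at this
    simpa [toReal] using this
  · rw [← hα]
    have := h.2 j
    rw [facetForm_some, totalWeight_div_deltaWeight hs hk] at this
    rw [Int.cast_sub, Int.cast_mul, Int.cast_sum]
    exact this

theorem exists_newtonFunction_le_spectralDegree (hs : 0 < s) (hk : 0 < k)
    (z : ZMod (totalWeight (deltaWeight (s * k) s))) :
    ∃ m : Fin (s * k) → ℤ, ((∑ i, m i : ℤ) : ZMod (totalWeight (deltaWeight (s * k) s))) = z ∧
      newtonFunction (newtonPolytope (simplexLaurent (deltaWeight (s * k) s))) (toReal m) ≤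
        spectralDegree s k z := by
  have hn : 0 < s * k := Nat.mul_pos hs hk
  have hN := totalWeight_deltaWeight hn
  revert z
  set N := totalWeight (deltaWeight (s * k) s) with hNdef
  intro z
  have hN0 : 0 < N := totalWeight_pos _
  have : NeZero N := ⟨hN0.ne'⟩
  let l : Fin (s * k) := ⟨s * k - 1, by omega⟩
  have hl : (l : ℕ) + 1 = s * k := by simp only [l]; omega
  -- it is enough to find a suitable multiple of the last basis vector
  suffices h : ∃ v : ℤ, (v : ZMod N) = z ∧ v ≤ spectralDegree s k z ∧
      v - (k + 1) * v ≤ spectralDegree s k z by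
    obtain ⟨v, hvz, hv1, hv2⟩ := h
    have hsum : ∑ i, (Pi.single l v : Fin (s * k) → ℤ) i = v := by simp
    refine ⟨Pi.single l v, by rw [hsum, hvz], ?_⟩
    rw [newtonFunction_simplexLaurent_le_iff (deltaWeight_pos hs), Option.forall]
    have hsum' : ∑ i, toReal (Pi.single l v : Fin (s * k) → ℤ) i = v := by
      rw [← Int.cast_inj (α := ℝ), Int.cast_sum] at hsum
      exact hsum
    have hv1' : (v : ℝ) ≤ (spectralDegree s k z : ℝ) := by exact_mod_cast hv1
    refine ⟨by rwa [facetForm_none, hsum'], fun j => ?_⟩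
    rw [facetForm_some, hsum', totalWeight_div_deltaWeight hs hk]
    by_cases hj : j = l
    · subst hj
      rw [if_pos hl]
      simp only [toReal, Pi.single_eq_same]
      exact_mod_cast hv2
    · simpa [toReal, Pi.single_eq_of_ne hj] using hv1'
  by_cases hz : z.val ≤ s * k
  · refine ⟨z.val, by simp, ?_, ?_⟩
    · rw [spectralDegree, if_pos hz]
    · rw [spectralDegree, if_pos hz]
      nlinarith [Int.natCast_nonneg z.val, Int.natCast_nonneg k]
  · have hlt := ZMod.val_lt z
    refine ⟨(z.val : ℤ) - N, by simp, ?_, ?_⟩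
    · omega
    · rw [spectralDegree, if_neg hz, Nat.cast_mul, Nat.cast_sub hlt.le]
      linarith

end SpectralDegree

/-! ### The Newton filtration in the group algebra -/

section Filtration

variable {s k : ℕ} {τ : ℂˣ} {c : Fin (s * k) → ℂˣ}

/-- Each monomial maps to a nonzero multiple of a group element, so no cancellation has to be
controlled: the two bounds on `spectralDegree` decide which group elements occur. -/
theorem jacobiStep_eq_comap (hs : 0 < s) (hk : 0 < k)
    (h : IsCriticalScaling (deltaWeight (s * k) s) τ c) (α : ℚ) :
    jacobiStep (simplexLaurent (deltaWeight (s * k) s)) α =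
      (AddMonoidAlgebra.supported ℂ ℂ {z | (spectralDegree s k z : ℚ) ≤ α}).comap
        (jacobiEquiv h).toLinearMap := by
  ext x
  constructor
  · rintro ⟨g, hg, rfl⟩
    change cyclicMap _ c g ∈ AddMonoidAlgebra.supported ℂ ℂ {z | (spectralDegree s k z : ℚ) ≤ α}
    rw [← AddMonoidAlgebra.sum_coeff_single g, Finsupp.sum, map_sum]
    refine Submodule.sum_mem _ fun m hm => ?_
    have hm' := spectralDegree_le_of_newtonFunction_le hs hk (hg m (Finsupp.mem_support_iff.1 hm))
    rw [cyclicMap_single, AddMonoidAlgebra.mem_supported']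
    intro z hz
    rw [AddMonoidAlgebra.coeff_single, Finsupp.single_apply, if_neg]
    rintro rfl
    exact hz hm'
  · intro hx
    have e : x = ∑ z ∈ (jacobiEquiv h x).coeff.support,
        (jacobiEquiv h).symm (AddMonoidAlgebra.single z ((jacobiEquiv h x).coeff z)) := by
      rw [← map_sum]
      apply (jacobiEquiv h).injective
      rw [AlgEquiv.apply_symm_apply]
      exact (AddMonoidAlgebra.sum_coeff_single _).symm
    rw [e]
    refine Submodule.sum_mem _ fun z hz => ?_
    obtain ⟨m, rfl, hm⟩ := exists_newtonFunction_le_spectralDegree hs hk z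
    have hz' : (spectralDegree s k
      ((∑ i, m i : ℤ) : ZMod (totalWeight (deltaWeight (s * k) s))) : ℚ) ≤ α :=
      AddMonoidAlgebra.mem_supported.1 hx hz
    set b := (jacobiEquiv h x).coeff ((∑ i, m i : ℤ) : ZMod _)
    refine ⟨AddMonoidAlgebra.single m (b * ((∏ i, c i ^ m i : ℂˣ) : ℂ)⁻¹), ?_, ?_⟩
    · intro m' hm'
      have : m = m' := by
        by_contra hne
        rw [AddMonoidAlgebra.coeff_single, Finsupp.single_apply, if_neg hne] at hm'
        exact hm' rfl
      subst this
      exact hm.trans (by exact_mod_cast hz')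
    · apply (jacobiEquiv h).injective
      rw [AlgEquiv.apply_symm_apply]
      refine (jacobiEquiv_mk h _).trans ?_
      rw [cyclicMap_single, inv_mul_cancel_right₀ (Units.ne_zero _)]

theorem mem_jacobiStep_iff (hs : 0 < s) (hk : 0 < k)
    (h : IsCriticalScaling (deltaWeight (s * k) s) τ c) {α : ℚ}
    {x : JacobiRing (simplexLaurent (deltaWeight (s * k) s))} :
    x ∈ jacobiStep (simplexLaurent (deltaWeight (s * k) s)) α ↔
      ∀ z, (jacobiEquiv h x).coeff z ≠ 0 → (spectralDegree s k z : ℚ) ≤ α := by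
  rw [jacobiStep_eq_comap hs hk h, Submodule.mem_comap, AddMonoidAlgebra.mem_supported']
  exact forall_congr' fun z => not_imp_comm

theorem mem_jacobiStepLT_iff (hs : 0 < s) (hk : 0 < k)
    (h : IsCriticalScaling (deltaWeight (s * k) s) τ c) {α : ℚ}
    {x : JacobiRing (simplexLaurent (deltaWeight (s * k) s))} :
    x ∈ jacobiStepLT (simplexLaurent (deltaWeight (s * k) s)) α ↔
      ∀ z, (jacobiEquiv h x).coeff z ≠ 0 → (spectralDegree s k z : ℚ) < α := by
  constructor
  · have hle : jacobiStepLT (simplexLaurent (deltaWeight (s * k) s)) α ≤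
        (AddMonoidAlgebra.supported ℂ ℂ {z | (spectralDegree s k z : ℚ) < α}).comap
          (jacobiEquiv h).toLinearMap := by
      refine iSup₂_le fun β hβ => ?_
      rw [jacobiStep_eq_comap hs hk h]
      exact Submodule.comap_mono (AddMonoidAlgebra.supported_mono fun z hz => hz.trans_lt hβ)
    intro hx z hz
    exact AddMonoidAlgebra.mem_supported.1 (hle hx) (Finsupp.mem_support_iff.2 hz)
  · intro hx
    have e : x = ∑ z ∈ (jacobiEquiv h x).coeff.support,
        (jacobiEquiv h).symm (AddMonoidAlgebra.single z ((jacobiEquiv h x).coeff z)) := by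
      rw [← map_sum]
      apply (jacobiEquiv h).injective
      rw [AlgEquiv.apply_symm_apply]
      exact (AddMonoidAlgebra.sum_coeff_single _).symm
    rw [e]
    refine Submodule.sum_mem _ fun z hz => ?_
    refine (le_iSup₂ (f := fun (δ : ℚ) (_ : δ < α) =>
      jacobiStep (simplexLaurent (deltaWeight (s * k) s)) δ) (spectralDegree s k z : ℚ)
      (hx z (Finsupp.mem_support_iff.1 hz))) ?_
    rw [mem_jacobiStep_iff hs hk h]
    intro z' hz'
    rw [AlgEquiv.apply_symm_apply, AddMonoidAlgebra.coeff_single, Finsupp.single_apply] at hz'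
    split_ifs at hz' with hzz
    · rw [hzz]
    · exact absurd rfl hz'

/-- The graded piece of degree `α` has a basis indexed by the elements of spectral degree `α`. -/
theorem nonempty_gr_equiv (hs : 0 < s) (hk : 0 < k) (α : ℚ) :
    Nonempty (Gr (simplexLaurent (deltaWeight (s * k) s)) α ≃ₗ[ℂ]
      ({z : ZMod (totalWeight (deltaWeight (s * k) s)) // (spectralDegree s k z : ℚ) = α} →₀ ℂ)) := by
  obtain ⟨τ, c, h⟩ := exists_isCriticalScaling (deltaWeight_pos (n := s * k) hs)
  set f := simplexLaurent (deltaWeight (s * k) s)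
  let S : Set (ZMod (totalWeight (deltaWeight (s * k) s))) := {z | (spectralDegree s k z : ℚ) = α}
  -- The symbol map: it keeps the coefficients at group elements of degree exactly α, so its kernel
  -- is the strictly smaller step.
  let L : jacobiStep f α →ₗ[ℂ] (S →₀ ℂ) :=
    (Finsupp.lcomapDomain (Subtype.val : S → _) Subtype.val_injective) ∘ₗ
      (AddMonoidAlgebra.coeffLinearEquiv ℂ).toLinearMap ∘ₗ (jacobiEquiv h).toLinearMap ∘ₗ
      (jacobiStep f α).subtype
  have hL : ∀ x (z : S), L x z = (jacobiEquiv h (x : JacobiRing f)).coeff z := fun x z => rfl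
  have hker : LinearMap.ker L = (jacobiStepLT f α).submoduleOf (jacobiStep f α) := by
    ext x
    rw [LinearMap.mem_ker, Submodule.submoduleOf, Submodule.mem_comap, Submodule.subtype_apply,
      mem_jacobiStepLT_iff hs hk h]
    have hx := (mem_jacobiStep_iff hs hk h).1 x.2
    constructor
    · intro h0 z hz
      refine lt_of_le_of_ne (hx z hz) fun he => hz ?_
      rw [← hL x ⟨z, he⟩, h0]
      rfl
    · intro h0
      ext z
      rw [hL]
      by_contra hz
      exact (h0 z hz).ne z.2
  have hsurj : Function.Surjective L := by
    intro y
    let x := (jacobiEquiv h).symm (AddMonoidAlgebra.ofCoeff (y.mapDomain Subtype.val))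
    have hx : jacobiEquiv h x = AddMonoidAlgebra.ofCoeff (y.mapDomain Subtype.val) :=
      AlgEquiv.apply_symm_apply _ _
    have hmem : x ∈ jacobiStep f α := by
      rw [mem_jacobiStep_iff hs hk h]
      intro z hz
      rw [hx] at hz
      by_contra hne
      refine hz (Finsupp.mapDomain_of_notMem_range _ _ ?_)
      rintro ⟨z', rfl⟩
      exact hne (le_of_eq z'.2)
    refine ⟨⟨x, hmem⟩, ?_⟩
    ext z
    rw [hL]
    simp only [hx]
    exact Finsupp.mapDomain_apply Subtype.val_injective _ _
  exact ⟨(Submodule.quotEquivOfEq _ _ hker.symm).trans (L.quotKerEquivOfSurjective hsurj)⟩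

end Filtration

/-! ### The spectrum polynomial and its unimodality -/

section Spectrum

theorem ofPolynomial_apply (p : ℕ[X]) (α : ℚ) :
    ofPolynomial p α = ∑ i ∈ p.support, if (i : ℚ) = α then p.coeff i else 0 := by
  rw [ofPolynomial, Polynomial.sum, Finset.sum_apply]
  refine Finset.sum_congr rfl fun i _ => ?_
  rw [Pi.single_apply]
  simp only [eq_comm]

theorem ofPolynomial_natCast (p : ℕ[X]) (i : ℕ) : ofPolynomial p (i : ℚ) = p.coeff i := by
  rw [ofPolynomial_apply]
  simp only [Nat.cast_inj]
  rw [Finset.sum_ite_eq']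
  split_ifs with h
  · rfl
  · exact (notMem_support_iff.1 h).symm

theorem ofPolynomial_of_forall_ne (p : ℕ[X]) {α : ℚ} (h : ∀ i : ℕ, (i : ℚ) ≠ α) :
    ofPolynomial p α = 0 := by
  rw [ofPolynomial_apply]
  exact Finset.sum_eq_zero fun i _ => if_neg (h i)

theorem ofPolynomial_injective : Function.Injective ofPolynomial := by
  intro p q h
  ext i
  rw [← ofPolynomial_natCast, h, ofPolynomial_natCast]

variable {s k : ℕ}

/-- The spectrum at infinity of `fDelta (s * k) s` as a polynomial. -/
def deltaSpectrum (s k : ℕ) : ℕ[X] :=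
  ∑ i ∈ Finset.range (s * k + 1), X ^ i + ∑ j ∈ Finset.Icc 1 (s - 1), X ^ (j * k)

theorem sum_zmod_val {R : Type*} [AddCommMonoid R] {N : ℕ} [NeZero N] (g : ℕ → R) :
    ∑ z : ZMod N, g z.val = ∑ v ∈ Finset.range N, g v := by
  refine Finset.sum_nbij' ZMod.val (fun v => (v : ZMod N)) ?_ ?_ ?_ ?_ ?_
  · exact fun z _ => Finset.mem_range.2 (ZMod.val_lt z)
  · exact fun v _ => Finset.mem_univ _
  · exact fun z _ => ZMod.natCast_zmod_val z
  · exact fun v hv => ZMod.val_cast_of_lt (Finset.mem_range.1 hv)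
  · exact fun z _ => rfl

/-- The residues 0, …, sk give the first sum; the remaining s - 1 residues are -j with 1 ≤ j ≤ s -
1, of degree jk. -/
theorem sum_X_pow_spectralDegree {N : ℕ} [NeZero N] (hN : N = s * (k + 1)) (hs : 0 < s) :
    ∑ z : ZMod N, (X : ℕ[X]) ^ spectralDegree s k z = deltaSpectrum s k := by
  have hN' : N = s * k + 1 + (s - 1) := by rw [hN, mul_add_one]; omega
  simp only [spectralDegree]
  rw [sum_zmod_val fun v => (X : ℕ[X]) ^ (if v ≤ s * k then v else k * (N - v)), deltaSpectrum]
  rw [congrArg Finset.range hN', Finset.sum_range_add]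
  refine congrArg₂ (· + ·) ?_ ?_
  · refine Finset.sum_congr rfl fun i hi => ?_
    rw [if_pos (by have := Finset.mem_range.1 hi; omega)]
  · refine Finset.sum_nbij' (fun x => s - 1 - x) (fun j => s - 1 - j) ?_ ?_ ?_ ?_ ?_
    · intro x hx
      simp only [Finset.mem_range, Finset.mem_Icc] at *
      omega
    · intro x hx
      simp only [Finset.mem_range, Finset.mem_Icc] at *
      omega
    · intro x hx
      simp only [Finset.mem_range] at *
      omega
    · intro x hx
      simp only [Finset.mem_Icc] at *
      omega
    · intro x hx
      rw [if_neg (by omega), mul_comm]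
      congr 2
      simp only [Finset.mem_range] at *
      omega

theorem spectrumAtInfinity_simplexLaurent (hs : 0 < s) (hk : 0 < k) :
    spectrumAtInfinity (simplexLaurent (deltaWeight (s * k) s)) =
      ofPolynomial (deltaSpectrum s k) := by
  classical
  set N := totalWeight (deltaWeight (s * k) s) with hNdef
  have hN : N = s * (k + 1) := totalWeight_deltaWeight (Nat.mul_pos hs hk)
  have : NeZero N := ⟨(totalWeight_pos _).ne'⟩
  ext α
  obtain ⟨e⟩ := nonempty_gr_equiv hs hk α
  rw [spectrumAtInfinity, e.finrank_eq, Module.finrank_finsupp_self, Fintype.card_subtype]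
  by_cases hα : ∃ i : ℕ, (i : ℚ) = α
  · obtain ⟨i, rfl⟩ := hα
    rw [ofPolynomial_natCast, ← sum_X_pow_spectralDegree hN hs, finsetSum_coeff,
      Finset.card_filter]
    refine Finset.sum_congr rfl fun z _ => ?_
    simp only [coeff_X_pow, Nat.cast_inj, eq_comm]
  · push Not at hα
    rw [ofPolynomial_of_forall_ne _ hα, Finset.card_eq_zero, Finset.filter_eq_empty_iff]
    exact fun z _ => hα _

theorem coeff_deltaSpectrum (s k i : ℕ) : (deltaSpectrum s k).coeff i =
    (if i < s * k + 1 then 1 else 0) +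
      ∑ j ∈ Finset.Icc 1 (s - 1), if i = j * k then 1 else 0 := by
  simp [deltaSpectrum, coeff_X_pow, Finset.sum_ite_eq]

theorem coeff_deltaSpectrum_mul {j : ℕ} (hk : 0 < k) (hj : 1 ≤ j) (hjs : j < s) :
    (deltaSpectrum s k).coeff (j * k) = 2 := by
  have h : j * k < s * k + 1 := Nat.lt_succ_of_le (Nat.mul_le_mul_right k hjs.le)
  simp only [coeff_deltaSpectrum, Nat.mul_left_inj hk.ne', if_pos h]
  rw [Finset.sum_ite_eq, if_pos (Finset.mem_Icc.2 ⟨hj, by omega⟩)]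

theorem coeff_deltaSpectrum_of_not_dvd {i : ℕ} (hi : i ≤ s * k) (hki : ¬ k ∣ i) :
    (deltaSpectrum s k).coeff i = 1 := by
  rw [coeff_deltaSpectrum, if_pos (Nat.lt_succ_of_le hi), Finset.sum_eq_zero, add_zero]
  exact fun j _ => if_neg fun (h : i = j * k) => hki (h ▸ dvd_mul_left k j)

theorem coeff_deltaSpectrum_two (k i : ℕ) : (deltaSpectrum 2 k).coeff i =
    (if i < 2 * k + 1 then 1 else 0) + if i = k then 1 else 0 := by
  rw [coeff_deltaSpectrum, show Finset.Icc 1 (2 - 1) = {1} from rfl, Finset.sum_singleton,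
    one_mul]

/-- For s ≥ 3 the coefficients drop from 2 to 1 after k and return to 2 at 2k; k ≥ 2 leaves room for
the dip. For s = 2 the only 2 is at k. -/
theorem isUnimodal_deltaSpectrum_iff (hs : 2 ≤ s) (hk : 2 ≤ k) :
    IsUnimodal (deltaSpectrum s k) ↔ s = 2 := by
  constructor
  · rintro ⟨j, hj1, hj2⟩
    by_contra hne
    have hs3 : 3 ≤ s := by omega
    have hle : 3 * k ≤ s * k := Nat.mul_le_mul_right k hs3
    have h1 : (deltaSpectrum s k).coeff k = 2 := by
      simpa using coeff_deltaSpectrum_mul (s := s) (k := k) (j := 1) (by omega) le_rfl (by omega)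
    have h2 : (deltaSpectrum s k).coeff (2 * k) = 2 :=
      coeff_deltaSpectrum_mul (by omega) (by omega) (by omega)
    have h3 : (deltaSpectrum s k).coeff (k + 1) = 1 := by
      refine coeff_deltaSpectrum_of_not_dvd (by omega) fun h => ?_
      have := Nat.le_of_dvd one_pos ((Nat.dvd_add_right (dvd_refl k)).1 h)
      omega
    have h4 : (deltaSpectrum s k).coeff (2 * k - 1) = 1 := by
      refine coeff_deltaSpectrum_of_not_dvd (by omega) fun h => ?_
      have h5 : k ∣ (2 * k - 1) + 1 := by
        rw [Nat.sub_add_cancel (by omega)]; exact dvd_mul_left k 2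
      have := Nat.le_of_dvd one_pos ((Nat.dvd_add_right h).1 h5)
      omega
    have hjk : j ≤ k := by
      by_contra! h
      have := hj1 k h
      omega
    have h5 := hj2 (2 * k - 1) (by omega)
    rw [Nat.sub_add_cancel (by omega)] at h5
    omega
  · rintro rfl
    refine ⟨k, fun i hi => ?_, fun i hi => ?_⟩ <;>
    · rw [coeff_deltaSpectrum_two, coeff_deltaSpectrum_two]
      split_ifs <;> omega

theorem hasUnimodalSpectrum_simplexLaurent_iff (hs : 2 ≤ s) (hk : 2 ≤ k) :
    HasUnimodalSpectrum (simplexLaurent (deltaWeight (s * k) s)) ↔ s = 2 := by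
  rw [← isUnimodal_deltaSpectrum_iff hs hk, HasUnimodalSpectrum,
    spectrumAtInfinity_simplexLaurent (by omega) (by omega)]
  constructor
  · rintro ⟨p, hp, hu⟩
    rwa [ofPolynomial_injective hp]
  · exact fun h => ⟨_, rfl, h⟩

end Spectrum

/-! ### The hard Lefschetz property -/

section Lefschetz

variable {s k : ℕ}

theorem coeff_jacobiEquiv_mulPow {n : ℕ} {w : Fin n → ℕ} {τ : ℂˣ} {c : Fin n → ℂˣ}
    (h : IsCriticalScaling w τ c) (r : ℕ) (x : JacobiRing (simplexLaurent w))
    (z : ZMod (totalWeight w)) :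
    (jacobiEquiv h (mulPow (simplexLaurent w) r x)).coeff z =
      ((totalWeight w : ℂ) * τ) ^ r * (jacobiEquiv h x).coeff (z - r) := by
  rw [mulPow, LinearMap.mulLeft_apply, map_mul, map_pow, jacobiEquiv_mk,
    cyclicMap_simplexLaurent h, AddMonoidAlgebra.single_pow, nsmul_one,
    AddMonoidAlgebra.coeff_single_mul_apply, neg_add_eq_sub]

theorem lefschetzMap_mk_eq_zero_iff {n : ℕ} {f : Laurent n} (hf : IsConvenient f) {r : ℕ}
    {α β : ℚ} (hβ : β = α + r) (x : jacobiStep f α) :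
    lefschetzMap f hf r α β hβ (Submodule.Quotient.mk x) = 0 ↔
      mulPow f r (x : JacobiRing f) ∈ jacobiStepLT f β := by
  exact Submodule.Quotient.mk_eq_zero _

theorem gr_mk_eq_zero_iff {n : ℕ} {f : Laurent n} {α : ℚ} (x : jacobiStep f α) :
    (Submodule.Quotient.mk x : Gr f α) = 0 ↔ (x : JacobiRing f) ∈ jacobiStepLT f α := by
  rw [Submodule.Quotient.mk_eq_zero]
  rfl

theorem subsingleton_gr (hs : 0 < s) (hk : 0 < k) {α : ℚ} (hα : ∀ i : ℕ, (i : ℚ) ≠ α) :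
    Subsingleton (Gr (simplexLaurent (deltaWeight (s * k) s)) α) := by
  obtain ⟨e⟩ := nonempty_gr_equiv hs hk α
  have : IsEmpty {z : ZMod (totalWeight (deltaWeight (s * k) s)) //
      (spectralDegree s k z : ℚ) = α} := ⟨fun z => hα _ z.2⟩
  exact e.toEquiv.subsingleton

theorem finiteDimensional_gr (hs : 0 < s) (hk : 0 < k) (α : ℚ) :
    FiniteDimensional ℂ (Gr (simplexLaurent (deltaWeight (s * k) s)) α) := by
  obtain ⟨e⟩ := nonempty_gr_equiv hs hk α
  have : NeZero (totalWeight (deltaWeight (s * k) s)) := ⟨(totalWeight_pos _).ne'⟩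
  exact Module.Finite.equiv e.symm

/-- The shift by r = 2k - 2i reflects degrees about k. The exceptional residue -1 has degree k,
which forces r = 0. -/
theorem spectralDegree_two_add {N : ℕ} (hN : N = 2 * (k + 1)) {i r : ℕ} (hir : 2 * i + r = 2 * k)
    {z : ZMod N} (hz : spectralDegree 2 k z = i) :
    spectralDegree 2 k (z + (r : ZMod N)) = 2 * k - i := by
  have : NeZero N := ⟨by omega⟩
  have hlt := ZMod.val_lt z
  by_cases h : z.val ≤ 2 * k
  · rw [spectralDegree, if_pos h] at hz
    have e : z + (r : ZMod N) = ((i + r : ℕ) : ZMod N) := by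
      rw [Nat.cast_add, ← hz, ZMod.natCast_zmod_val]
    have hv : ((i + r : ℕ) : ZMod N).val = i + r := ZMod.val_cast_of_lt (by omega)
    rw [e, spectralDegree, hv, if_pos (by omega)]
    omega
  · have hz' := hz
    rw [spectralDegree, if_neg h, show N - z.val = 1 by omega, mul_one] at hz'
    have hr : r = 0 := by omega
    rw [hr, Nat.cast_zero, add_zero, hz]
    omega

theorem lefschetzMap_bijective_two (hk : 0 < k)
    (hconv : IsConvenient (simplexLaurent (deltaWeight (2 * k) 2))) {i r : ℕ}
    (hir : 2 * i + r = 2 * k) {β : ℚ} (hβ : β = (i : ℚ) + r) :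
    Function.Bijective (lefschetzMap _ hconv r (i : ℚ) β hβ) := by
  obtain ⟨τ, c, h⟩ := exists_isCriticalScaling (deltaWeight_pos (n := 2 * k) two_pos)
  have hβ' : β = ((2 * k - i : ℕ) : ℚ) := by
    rw [hβ, ← Nat.cast_add]
    congr 1
    omega
  have := finiteDimensional_gr (s := 2) two_pos hk (i : ℚ)
  have := finiteDimensional_gr (s := 2) two_pos hk β
  have hrank : Module.finrank ℂ (Gr (simplexLaurent (deltaWeight (2 * k) 2)) (i : ℚ)) =
      Module.finrank ℂ (Gr (simplexLaurent (deltaWeight (2 * k) 2)) β) := by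
    have e := spectrumAtInfinity_simplexLaurent (s := 2) two_pos hk
    have e1 := congrFun e (i : ℚ)
    have e2 := congrFun e β
    rw [hβ', ofPolynomial_natCast, coeff_deltaSpectrum_two] at e2
    rw [ofPolynomial_natCast, coeff_deltaSpectrum_two] at e1
    rw [spectrumAtInfinity] at e1 e2
    rw [e1, hβ', e2]
    split_ifs <;> omega
  have hinj : Function.Injective (lefschetzMap _ hconv r (i : ℚ) β hβ) := by
    rw [injective_iff_map_eq_zero]
    intro y hy
    obtain ⟨x, rfl⟩ := Submodule.Quotient.mk_surjective _ y
    rw [lefschetzMap_mk_eq_zero_iff, mem_jacobiStepLT_iff two_pos hk h] at hy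
    rw [gr_mk_eq_zero_iff, mem_jacobiStepLT_iff two_pos hk h]
    intro z hz
    -- A component of exact degree i would be shifted to one of exact degree β, which `hy` excludes.
    -- Surjectivity then follows from the symmetry of the dimensions.
    refine ((mem_jacobiStep_iff two_pos hk h).1 x.2 z hz).lt_of_ne fun hzi => ?_
    have hd := spectralDegree_two_add (totalWeight_deltaWeight (s := 2) (by omega)) hir
      (Nat.cast_injective hzi)
    have hlt := hy (z + r) ?_
    · rw [hd, hβ'] at hlt
      exact hlt.false
    · rw [coeff_jacobiEquiv_mulPow, add_sub_cancel_right]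
      exact mul_ne_zero (pow_ne_zero _ (mul_ne_zero
        (Nat.cast_ne_zero.2 (totalWeight_pos _).ne') (Units.ne_zero _))) hz
  exact ⟨hinj, (LinearMap.injective_iff_surjective_of_finrank_eq_finrank hrank).1 hinj⟩

/-- The witness is T^(-1), of degree k: its image is a multiple of T^((s-2)k-1), of degree at most
(s-2)k - 1 < β. -/
theorem lefschetzMap_not_injective (hs : 3 ≤ s) (hk : 0 < k)
    (hconv : IsConvenient (simplexLaurent (deltaWeight (s * k) s))) {β : ℚ}
    (hβ : β = (k : ℚ) + ((s - 2) * k : ℕ)) :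
    ¬ Function.Injective (lefschetzMap _ hconv ((s - 2) * k) (k : ℚ) β hβ) := by
  have hs0 : 0 < s := by omega
  obtain ⟨τ, c, h⟩ := exists_isCriticalScaling (deltaWeight_pos (n := s * k) hs0)
  have hN := totalWeight_deltaWeight (Nat.mul_pos hs0 hk)
  have hr : 1 ≤ (s - 2) * k := Nat.mul_pos (by omega) hk
  have hdeg : spectralDegree s k (-1 : ZMod (totalWeight (deltaWeight (s * k) s))) = k := by
    simpa using spectralDegree_neg_natCast hN one_pos (by omega)
  intro hinj
  let x := (jacobiEquiv h).symm (AddMonoidAlgebra.single (-1) 1)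
  have hx : ∀ z, (jacobiEquiv h x).coeff z ≠ 0 ↔ z = -1 := by
    intro z
    rw [AlgEquiv.apply_symm_apply, AddMonoidAlgebra.coeff_single, Finsupp.single_apply]
    simp [eq_comm]
  have hmem : x ∈ jacobiStep (simplexLaurent (deltaWeight (s * k) s)) (k : ℚ) := by
    rw [mem_jacobiStep_iff hs0 hk h]
    intro z hz
    rw [(hx z).1 hz, hdeg]
  have h0 : lefschetzMap _ hconv ((s - 2) * k) (k : ℚ) β hβ
      (Submodule.Quotient.mk ⟨x, hmem⟩) = 0 := by
    rw [lefschetzMap_mk_eq_zero_iff, mem_jacobiStepLT_iff hs0 hk h]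
    intro z hz
    rw [coeff_jacobiEquiv_mulPow] at hz
    have hz' := (hx _).1 (right_ne_zero_of_mul hz)
    have e : z = (((s - 2) * k - 1 : ℕ) : ZMod _) := by
      rw [Nat.cast_sub hr, Nat.cast_one]
      linear_combination hz'
    have hle := spectralDegree_natCast_le hN ((s - 2) * k - 1)
    rw [e, hβ, ← Nat.cast_add, Nat.cast_lt]
    omega
  have h1 := hinj (h0.trans (map_zero _).symm)
  rw [gr_mk_eq_zero_iff, mem_jacobiStepLT_iff hs0 hk h] at h1
  have h2 := h1 (-1) ((hx _).2 rfl)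
  rw [hdeg] at h2
  exact h2.false

theorem satisfiesHL_simplexLaurent_iff (hs : 2 ≤ s) (hk : 0 < k)
    (hconv : IsConvenient (simplexLaurent (deltaWeight (s * k) s))) :
    SatisfiesHL (simplexLaurent (deltaWeight (s * k) s)) hconv ↔ s = 2 := by
  constructor
  · intro hHL
    by_contra hne
    have hs3 : 3 ≤ s := by omega
    have e : 2 * k + (s - 2) * k = s * k := by
      rw [← add_mul]; congr 1; omega
    exact lefschetzMap_not_injective hs3 hk hconv _ (hHL.2 k ((s - 2) * k) e).injective
  · rintro rfl
    -- All spectral degrees are integers, so the graded pieces in the first family of conditions are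
    -- zero.
    refine ⟨fun i r h α h0 h1 => ?_, fun i r h => lefschetzMap_bijective_two hk hconv h _⟩
    have hint : ∀ (α : ℚ), 0 < α → α < 1 → ∀ a j : ℤ, (a : ℚ) ≠ α + j := by
      intro α h0 h1 a j ha
      have e : α = ((a - j : ℤ) : ℚ) := by push_cast; linarith
      rw [e] at h0 h1
      have h0' : 0 < a - j := by exact_mod_cast h0
      have h1' : a - j < 1 := by exact_mod_cast h1
      omega
    have hsub1 := subsingleton_gr (s := 2) two_pos hk (α := α + i) fun a =>
      by exact_mod_cast hint α h0 h1 a i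
    have hsub2 := subsingleton_gr (s := 2) two_pos hk (α := α + ((2 * k : ℕ) : ℚ) - 1 - i)
      fun a ha => hint α h0 h1 a (2 * k - 1 - i) (by push_cast at ha ⊢; linarith)
    exact ⟨fun _ _ _ => Subsingleton.elim _ _, fun y => ⟨0, Subsingleton.elim _ _⟩⟩

end Lefschetz

end

end LaurentHL

theorem mainTheorem9 (s k : ℕ) (hs : 2 ≤ s) (hk : 2 ≤ k) :
    ∃ hconv : LaurentHL.IsConvenient (LaurentHL.fDelta (s * k) s),
      LaurentHL.IsNondegenerate (LaurentHL.fDelta (s * k) s) ∧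
      LaurentHL.milnorNumber (LaurentHL.fDelta (s * k) s) = s * (k + 1) ∧
      LaurentHL.polytopeMilnorNumber
        (LaurentHL.newtonPolytope (LaurentHL.fDelta (s * k) s)) = ((s * (k + 1) : ℕ) : ENNReal) ∧
      LaurentHL.spectrumAtInfinity (LaurentHL.fDelta (s * k) s) =
        LaurentHL.ofPolynomial
          (∑ i ∈ Finset.range (s * k + 1), X ^ i + ∑ j ∈ Finset.Icc 1 (s - 1), X ^ (j * k)) ∧
      (LaurentHL.HasUnimodalSpectrum (LaurentHL.fDelta (s * k) s) ↔ s = 2) ∧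
      (LaurentHL.SatisfiesHL (LaurentHL.fDelta (s * k) s) hconv ↔ s = 2) := by
  have hs0 : 0 < s := by omega
  have hk0 : 0 < k := by omega
  have hw := LaurentHL.deltaWeight_pos (n := s * k) hs0
  have hN := LaurentHL.totalWeight_deltaWeight (Nat.mul_pos hs0 hk0)
  rw [LaurentHL.fDelta_eq_simplexLaurent]
  refine ⟨LaurentHL.isConvenient_simplexLaurent hw, LaurentHL.isNondegenerate_simplexLaurent hw,
    ?_, ?_, LaurentHL.spectrumAtInfinity_simplexLaurent hs0 hk0,
    LaurentHL.hasUnimodalSpectrum_simplexLaurent_iff hs hk,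
    LaurentHL.satisfiesHL_simplexLaurent_iff hs hk0 _⟩
  · rw [LaurentHL.milnorNumber_simplexLaurent hw, hN]
  · rw [LaurentHL.polytopeMilnorNumber_simplexLaurent hw, hN]
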